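/- Let $m\ge 2$, let $\beta\neq0$ be real, and let $f_{i,i+1}, f_{i+1,i}$ ($i=1,\dots,m-1$) be nonzero real constants such that $f_{i,i+1}$ and $f_{i+1,i}$ have the same sign for every $i$ (in particular, they may be arbitrary positive numbers); put $f_{1,0}=f_{m,m+1}=0$. Consider the multi-layer quasi-geostrophic system for the functions $\psi^1,\dots,\psi^m$ of $(t,x,y)$, \[ q^i_t+\psi^i_xq^i_y-\psi^i_yq^i_x=0,\qquad q^i:=\psi^i_{xx}+\psi^i_{yy}+f_{i,i-1}(\psi^{i-1}-\psi^i)-f_{i,i+1}(\psi^i-\psi^{i+1})+\beta y,\qquad i=1,\dots,m. \] A vector field $Q=\tau\partial_t+\xi^x\partial_x+\xi^y\partial_y+\sum_i\eta^i\partial_{\psi^i}$, whose components are smooth functions of $(t,x,y,\psi^1,\dots,\psi^m)$ on an open convex set $U\subseteq\mathbb R^{3+m}$ (for example $U=\mathbb R^{3+m}$), is called a Lie symmetry vector field of the system if its third prolongation annihilates the left-hand side of each equation at all points of the third-order jet space over $U$ that satisfy the system. The set $\mathfrak g$ of all Lie symmetry vector fields on $U$ (the maximal Lie invariance algebra of the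 system) is closed under the Lie bracket of vector fields, and it is the linear span over $\mathbb R$ of the vector fields \[ \partial_t,\quad \partial_y,\quad \mathcal P^x(\chi)=\chi(t)\partial_x-y\chi_t(t)\big(\partial_{\psi^1}+\dots+\partial_{\psi^m}\big),\quad \partial_{\psi^1},\ \dots,\ \partial_{\psi^m},\quad \mathcal Z(\kappa)=\kappa(t)\big(\partial_{\psi^1}+\dots+\partial_{\psi^m}\big) \] (restricted to $U$), where $\chi$ and $\kappa$ run through the smooth functions of $t$ on the interval of the values that $t$ takes on $U$. In particular, $\mathfrak g$ does not depend on the constants $f_{i,i\pm1}$ and $\beta$. -/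

import Mathlib

open scoped ContDiff

namespace MultiLayerQG

noncomputable section

/-- The space with coordinates `(t, x, y, ψ¹, …, ψᵐ)`.
The independent variables `t, x, y` are numbered `0, 1, 2`. -/
abbrev PointSpace (m : ℕ) : Type := (Fin 3 → ℝ) × (Fin m → ℝ)

/-- The infinite jet space. A jet `z` consists of a point `z.1 = (t, x, y)` and of the values
`z.2 i J = ψⁱ_J` of all derivatives of the dependent variables, where the multi-index
`J : Fin 3 → ℕ` counts the differentiations in `t`, `x` and `y`. -/
abbrev JetSpace (m : ℕ) : Type := (Fin 3 → ℝ) × (Fin m → (Fin 3 → ℕ) → ℝ)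

/-- A vector field `τ ∂_t + ξˣ ∂_x + ξʸ ∂_y + ∑ ηⁱ ∂_{ψⁱ}`: the first component of its value is
`(τ, ξˣ, ξʸ)`, the second one is `(η¹, …, ηᵐ)`. -/
abbrev VField (m : ℕ) : Type := PointSpace m → PointSpace m

variable {m : ℕ}

/-- The point `(t, x, y, ψ)` over which a jet lies. -/
def toPoint (z : JetSpace m) : PointSpace m := (z.1, fun i => z.2 i 0)

/-- The multi-index of a single differentiation in the `k`th independent variable. -/
def idx (k : Fin 3) : Fin 3 → ℕ := Pi.single k 1

/-- The total derivative `D_k = ∂_k + ∑ ψⁱ_{J + k} ∂_{ψⁱ_J}`, as the derivative along the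
vector with the components `1` at `∂_k` and `ψⁱ_{J + k}` at `∂_{ψⁱ_J}`. -/
def totalDeriv (k : Fin 3) (F : JetSpace m → ℝ) : JetSpace m → ℝ := fun z =>
  lineDeriv ℝ F z (Pi.single k 1, fun i J => z.2 i (J + idx k))

/-- The iterated total derivative `D_J`. -/
def totalDerivMulti (J : Fin 3 → ℕ) (F : JetSpace m → ℝ) : JetSpace m → ℝ :=
  (totalDeriv 0)^[J 0] ((totalDeriv 1)^[J 1] ((totalDeriv 2)^[J 2] F))

/-- The characteristic `ηⁱ - τ ψⁱ_t - ξˣ ψⁱ_x - ξʸ ψⁱ_y` of a vector field. -/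
def characteristic (Q : VField m) (i : Fin m) : JetSpace m → ℝ := fun z =>
  (Q (toPoint z)).2 i - ∑ k, (Q (toPoint z)).1 k * z.2 i (idx k)

/-- The prolongation of a vector field to the jet space. Its component at `∂_{ψⁱ_J}` is
`D_J (ηⁱ - τ ψⁱ_t - ξˣ ψⁱ_x - ξʸ ψⁱ_y) + τ ψⁱ_{J + t} + ξˣ ψⁱ_{J + x} + ξʸ ψⁱ_{J + y}`. -/
def prolongation (Q : VField m) : JetSpace m → JetSpace m := fun z =>
  ((Q (toPoint z)).1, fun i J =>
    totalDerivMulti J (characteristic Q i) z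
      + ∑ k, (Q (toPoint z)).1 k * z.2 i (J + idx k))

/-- The potential vorticity
`qⁱ = ψⁱ_xx + ψⁱ_yy + f_{i,i-1} (ψⁱ⁻¹ - ψⁱ) - f_{i,i+1} (ψⁱ - ψⁱ⁺¹) + β y`. The sum over the
layers `j` adjacent to `i` omits the terms with `f_{1,0}` and `f_{m,m+1}`, which are zero. -/
def vorticity (f : Fin m → Fin m → ℝ) (β : ℝ) (i : Fin m) : JetSpace m → ℝ := fun z =>
  z.2 i (idx 1 + idx 1) + z.2 i (idx 2 + idx 2)
    + (∑ j : Fin m, if i.val + 1 = j.val ∨ j.val + 1 = i.val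
        then f i j * (z.2 j 0 - z.2 i 0) else 0)
    + β * z.1 2

/-- The left-hand side `qⁱ_t + ψⁱ_x qⁱ_y - ψⁱ_y qⁱ_x` of the `i`th equation of the system. -/
def qgEquation (f : Fin m → Fin m → ℝ) (β : ℝ) (i : Fin m) : JetSpace m → ℝ := fun z =>
  totalDeriv 0 (vorticity f β i) z
    + z.2 i (idx 1) * totalDeriv 2 (vorticity f β i) z
    - z.2 i (idx 2) * totalDeriv 1 (vorticity f β i) z

/-- `Q` is a Lie symmetry vector field, on the open set `U`, of the system with the parameters
`f` and `β`: its components are smooth, and the prolongation of `Q` annihilates the left-hand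
sides of the equations at all jets over `U` that satisfy the system. (The left-hand sides have
order three, so only the third prolongation of `Q` is involved.) -/
def IsLieSymmetryOn (f : Fin m → Fin m → ℝ) (β : ℝ) (U : Set (PointSpace m))
    (Q : VField m) : Prop :=
  ContDiffOn ℝ ∞ Q U ∧
    ∀ z : JetSpace m, toPoint z ∈ U → (∀ i, qgEquation f β i z = 0) →
      ∀ i, lineDeriv ℝ (qgEquation f β i) z (prolongation Q z) = 0

/-- The maximal Lie invariance algebra on `U`: all Lie symmetry vector fields. The values of a
vector field outside `U` play no role. -/
def maxLieInvarianceAlgebra (f : Fin m → Fin m → ℝ) (β : ℝ) (U : Set (PointSpace m)) :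
    Set (VField m) :=
  {Q | IsLieSymmetryOn f β U Q}

/-- `∂_t` -/
def fieldPt : VField m := fun _ => (Pi.single 0 1, 0)

/-- `∂_y` -/
def fieldPy : VField m := fun _ => (Pi.single 2 1, 0)

/-- `χ(t) ∂_x - y χ_t(t) (∂_{ψ¹} + … + ∂_{ψᵐ})` -/
def fieldPx (χ : ℝ → ℝ) : VField m := fun p =>
  (Pi.single 1 (χ (p.1 0)), fun _ => -(p.1 2 * deriv χ (p.1 0)))

/-- `∂_{ψⁱ}` -/
def fieldJ (i : Fin m) : VField m := fun _ => (0, Pi.single i 1)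

/-- `κ(t) (∂_{ψ¹} + … + ∂_{ψᵐ})` -/
def fieldZ (κ : ℝ → ℝ) : VField m := fun p => (0, fun _ => κ (p.1 0))

/-- The values that the variable `t` takes on `U`. -/
def timeRange (U : Set (PointSpace m)) : Set ℝ := (fun p => p.1 0) '' U

/-- The spanning vector fields, with parameter functions `χ` and `κ` of `t` that are smooth where
they are needed, that is, on the set of the values of `t` on `U`. -/
def spanningFields (U : Set (PointSpace m)) : Set (VField m) :=
  {fieldPt, fieldPy}
    ∪ {Q | ∃ χ : ℝ → ℝ, ContDiffOn ℝ ∞ χ (timeRange U) ∧ Q = fieldPx χ}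
    ∪ Set.range fieldJ
    ∪ {Q | ∃ κ : ℝ → ℝ, ContDiffOn ℝ ∞ κ (timeRange U) ∧ Q = fieldZ κ}

end

end MultiLayerQG

/-! The determining equations are extracted from jets whose second-order derivatives vanish
(`oddJet`). Over such a jet both the system and the invariance criterion are affine in the
third-order derivatives, with coefficients that depend on the point and on the slopes ψⁱ_k. The
linear part of the criterion therefore vanishes on every third-order perturbation that is tangent to
the system (`IsLieSymmetryOn.criterionPrincipal_eq_zero`), and a few explicit perturbations give
everything of first order.

A perturbation in a layer j ≠ i shows that τ, ξˣ, ξʸ do not depend on ψ and that ηⁱ depends on no ψʲ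
with j ≠ i; this needs a second layer. Perturbations within one layer give `first_order_relations`:
τ_x = τ_y = 0, the Cauchy-Riemann equations ξˣ_x = ξʸ_y and ξʸ_x = -ξˣ_y, and ηⁱ_x = ξʸ_t, ηⁱ_y =
-ξˣ_t, ηⁱ_ψⁱ = 2ξˣ_x - τ_t.

What is left of the criterion is a condition on slopes alone (`criterionLower_eq`), used for three
kinds of slopes. A slope ψʲ_t in one neighbouring layer gives ξˣ_x = 0 (`horizontal_stretch`): the
coupling fixes a length scale. Spatial slopes equal in all layers are invisible to the coupling and
give τ_t = 0 and ξʸ_x = 0, as β ≠ 0 (`criterion_uniform`). Zero slopes then say that the coupling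
operator maps (η¹_t, …, ηᵐ_t) to the vector with all entries -β ξʸ_t. The coupling is a weighted
Laplacian of a path whose opposite weights have equal signs, so a constant vector in its image is
zero and its kernel consists of the constant vectors (`coupling_const_eq_zero`,
`eq_of_coupling_eq_zero`). Hence ξʸ_t = 0, and ηⁱ_t is the same in all layers.

Integrating these gradients over the convex set U gives the combinations of the spanning fields
(`IsLieSymmetryOn.isNormalOn`). The converse is a direct prolongation
(`IsNormalOn.isLieSymmetryOn`), and closure under the bracket follows from the normal form
(`IsNormalOn.lieBracket`). -/

namespace MultiLayerQG

noncomputable section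

variable {m : ℕ}

/-! ### Total derivatives and the third prolongation in coordinates -/

section

/-- The vector field on the jet space along which `totalDeriv k` differentiates. -/
def jetShift (k : Fin 3) (z : JetSpace m) : JetSpace m :=
  (Pi.single k 1, fun i J => z.2 i (J + idx k))

theorem totalDeriv_eq_of_hasLineDerivAt {k : Fin 3} {F : JetSpace m → ℝ} {F' : ℝ} {z : JetSpace m}
    (h : HasLineDerivAt ℝ F F' z (jetShift k z)) : totalDeriv k F z = F' :=
  h.lineDeriv

theorem toPoint_add_smul (z v : JetSpace m) (s : ℝ) :
    toPoint (z + s • v) = toPoint z + s • toPoint v := rfl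

theorem hasDerivAt_toPoint_line (z v : JetSpace m) :
    HasDerivAt (fun s : ℝ => toPoint (z + s • v)) (toPoint v) 0 := by
  simp only [toPoint_add_smul]
  simpa using ((hasDerivAt_id (0 : ℝ)).smul_const (toPoint v)).const_add (toPoint z)

theorem hasLineDerivAt_coord (i : Fin m) (J : Fin 3 → ℕ) (z v : JetSpace m) :
    HasLineDerivAt ℝ (fun z : JetSpace m => z.2 i J) (v.2 i J) z v := by
  have : HasDerivAt (fun s : ℝ => z.2 i J + s * v.2 i J) (v.2 i J) 0 := by
    simpa using ((hasDerivAt_id (0 : ℝ)).mul_const (v.2 i J)).const_add (z.2 i J)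
  exact this

theorem hasLineDerivAt_base (k : Fin 3) (z v : JetSpace m) :
    HasLineDerivAt ℝ (fun z : JetSpace m => z.1 k) (v.1 k) z v := by
  have : HasDerivAt (fun s : ℝ => z.1 k + s * v.1 k) (v.1 k) 0 := by
    simpa using ((hasDerivAt_id (0 : ℝ)).mul_const (v.1 k)).const_add (z.1 k)
  exact this

theorem hasLineDerivAt_comp_toPoint {E : Type*} [NormedAddCommGroup E] [NormedSpace ℝ E]
    {g : PointSpace m → E} {z : JetSpace m} (hg : DifferentiableAt ℝ g (toPoint z))
    (v : JetSpace m) :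
    HasLineDerivAt ℝ (fun z => g (toPoint z)) (fderiv ℝ g (toPoint z) (toPoint v)) z v := by
  have h0 : toPoint (z + (0 : ℝ) • v) = toPoint z := by simp
  have hg' : HasFDerivAt g (fderiv ℝ g (toPoint z)) (toPoint (z + (0 : ℝ) • v)) := by
    rw [h0]; exact hg.hasFDerivAt
  exact hg'.comp_hasDerivAt (0 : ℝ) (hasDerivAt_toPoint_line z v)

theorem _root_.HasLineDerivAt.mul' {E : Type*} [AddCommGroup E] [Module ℝ E] {F G : E → ℝ}
    {F' G' : ℝ} {z v : E} (hF : HasLineDerivAt ℝ F F' z v) (hG : HasLineDerivAt ℝ G G' z v) :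
    HasLineDerivAt ℝ (fun z => F z * G z) (F' * G z + F z * G') z v := by
  have := HasDerivAt.fun_mul hF hG
  simpa [HasLineDerivAt] using this

/-- A short piece of the line through z still lies over the open set U. Iterated total derivatives
can thus be computed one at a time from formulas that hold only over U. -/
theorem totalDeriv_congr {U : Set (PointSpace m)} (hU : IsOpen U) {F G : JetSpace m → ℝ}
    (h : ∀ z, toPoint z ∈ U → F z = G z) (k : Fin 3) {z : JetSpace m} (hz : toPoint z ∈ U) :
    totalDeriv k F z = totalDeriv k G z := by
  unfold totalDeriv lineDeriv
  apply Filter.EventuallyEq.deriv_eq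
  have hc := (hasDerivAt_toPoint_line z
    (Pi.single k 1, fun i J => z.2 i (J + idx k))).continuousAt
  have : ∀ᶠ s : ℝ in nhds 0, toPoint (z + s •
      ((Pi.single k 1, fun i J => z.2 i (J + idx k)) : JetSpace m)) ∈ U :=
    hc.eventually_mem (hU.mem_nhds (by simpa using hz))
  filter_upwards [this] with s hs using h _ hs

theorem totalDerivMulti_idx (F : JetSpace m → ℝ) (a : Fin 3) :
    totalDerivMulti (idx a) F = totalDeriv a F := by
  fin_cases a <;> simp [totalDerivMulti, idx]

/-- `totalDerivMulti` differentiates in y first and in t last. With sorted indices this is already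
the order on the right, so total derivatives never have to be commuted. -/
theorem totalDerivMulti_idx_add_idx_add_idx (F : JetSpace m → ℝ) {a b c : Fin 3} (hab : a ≤ b)
    (hbc : b ≤ c) :
    totalDerivMulti (idx a + idx b + idx c) F
      = totalDeriv a (totalDeriv b (totalDeriv c F)) := by
  fin_cases a <;> fin_cases b <;> fin_cases c <;> first
    | (exfalso; revert hab hbc; decide)
    | simp [totalDerivMulti, idx]

/-- The vector with the components `ψⁱ_k` in the fibre and `∂_k` in the base. -/
def tangentVec (k : Fin 3) (z : JetSpace m) : PointSpace m :=
  (Pi.single k 1, fun i => z.2 i (idx k))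

/-- The vector with the components `ψⁱ_J` in the fibre. -/
def fibreVec (J : Fin 3 → ℕ) (z : JetSpace m) : PointSpace m := (0, fun i => z.2 i J)

theorem toPoint_jetShift (k : Fin 3) (z : JetSpace m) :
    toPoint (jetShift k z) = tangentVec k z := by
  simp [toPoint, jetShift, tangentVec]

theorem hasLineDerivAt_tangentVec (c a : Fin 3) (z : JetSpace m) :
    HasLineDerivAt ℝ (tangentVec c) (fibreVec (idx c + idx a) z) z (jetShift a z) := by
  have h : ∀ s : ℝ, tangentVec c (z + s • jetShift a z)
      = tangentVec c z + s • fibreVec (idx c + idx a) z := by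
    intro s
    simp only [tangentVec, fibreVec, jetShift]
    ext x <;> simp
  simp only [HasLineDerivAt, h]
  simpa using ((hasDerivAt_id (0 : ℝ)).smul_const
    (fibreVec (idx c + idx a) z)).const_add (tangentVec c z)

theorem hasLineDerivAt_fibreVec (J : Fin 3 → ℕ) (a : Fin 3) (z : JetSpace m) :
    HasLineDerivAt ℝ (fibreVec J) (fibreVec (J + idx a) z) z (jetShift a z) := by
  have h : ∀ s : ℝ, fibreVec J (z + s • jetShift a z)
      = fibreVec J z + s • fibreVec (J + idx a) z := by
    intro s
    simp only [fibreVec, jetShift]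
    ext x <;> simp
  simp only [HasLineDerivAt, h]
  simpa using ((hasDerivAt_id (0 : ℝ)).smul_const
    (fibreVec (J + idx a) z)).const_add (fibreVec J z)

/-- `D_a g` -/
def totalOne (g : PointSpace m → ℝ) (a : Fin 3) (z : JetSpace m) : ℝ :=
  fderiv ℝ g (toPoint z) (tangentVec a z)

/-- `D_b D_c g` -/
def totalTwo (g : PointSpace m → ℝ) (b c : Fin 3) (z : JetSpace m) : ℝ :=
  fderiv ℝ (fderiv ℝ g) (toPoint z) (tangentVec b z) (tangentVec c z)
    + fderiv ℝ g (toPoint z) (fibreVec (idx c + idx b) z)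

/-- `D_a D_b D_c g` -/
def totalThree (g : PointSpace m → ℝ) (a b c : Fin 3) (z : JetSpace m) : ℝ :=
  fderiv ℝ (fderiv ℝ (fderiv ℝ g)) (toPoint z) (tangentVec a z) (tangentVec b z) (tangentVec c z)
    + fderiv ℝ (fderiv ℝ g) (toPoint z) (fibreVec (idx b + idx a) z) (tangentVec c z)
    + fderiv ℝ (fderiv ℝ g) (toPoint z) (tangentVec b z) (fibreVec (idx c + idx a) z)
    + fderiv ℝ (fderiv ℝ g) (toPoint z) (tangentVec a z) (fibreVec (idx c + idx b) z)
    + fderiv ℝ g (toPoint z) (fibreVec (idx c + idx b + idx a) z)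

theorem _root_.ContDiffAt.fderiv_infty {E F : Type*} [NormedAddCommGroup E] [NormedSpace ℝ E]
    [NormedAddCommGroup F] [NormedSpace ℝ F] {g : E → F} {p : E} (hg : ContDiffAt ℝ ∞ g p) :
    ContDiffAt ℝ ∞ (fderiv ℝ g) p :=
  hg.fderiv_right (by simp)

theorem _root_.ContDiffAt.differentiableAt_infty {E F : Type*} [NormedAddCommGroup E]
    [NormedSpace ℝ E] [NormedAddCommGroup F] [NormedSpace ℝ F] {g : E → F} {p : E}
    (hg : ContDiffAt ℝ ∞ g p) : DifferentiableAt ℝ g p :=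
  hg.differentiableAt (by simp)

theorem hasLineDerivAt_comp_totalOne {g : PointSpace m → ℝ} {z : JetSpace m}
    (hg : ContDiffAt ℝ ∞ g (toPoint z)) (a : Fin 3) :
    HasLineDerivAt ℝ (fun z => g (toPoint z)) (totalOne g a z) z (jetShift a z) := by
  have := hasLineDerivAt_comp_toPoint hg.differentiableAt_infty (jetShift a z)
  rwa [toPoint_jetShift] at this

theorem hasLineDerivAt_totalOne {g : PointSpace m → ℝ} {z : JetSpace m}
    (hg : ContDiffAt ℝ ∞ g (toPoint z)) (b c : Fin 3) :
    HasLineDerivAt ℝ (totalOne g c) (totalTwo g b c z) z (jetShift b z) := by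
  have h1 := hasLineDerivAt_comp_toPoint hg.fderiv_infty.differentiableAt_infty (jetShift b z)
  have h2 := hasLineDerivAt_tangentVec c b z
  rw [toPoint_jetShift] at h1
  have := HasDerivAt.clm_apply h1 h2
  simpa [HasLineDerivAt, totalOne, totalTwo] using this

theorem hasLineDerivAt_totalTwo {g : PointSpace m → ℝ} {z : JetSpace m}
    (hg : ContDiffAt ℝ ∞ g (toPoint z)) (a b c : Fin 3) :
    HasLineDerivAt ℝ (totalTwo g b c) (totalThree g a b c z) z (jetShift a z) := by
  have h2 := hasLineDerivAt_comp_toPoint hg.fderiv_infty.fderiv_infty.differentiableAt_infty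
    (jetShift a z)
  have h1 := hasLineDerivAt_comp_toPoint hg.fderiv_infty.differentiableAt_infty (jetShift a z)
  rw [toPoint_jetShift] at h1 h2
  have := ((HasDerivAt.clm_apply h2 (hasLineDerivAt_tangentVec b a z)).clm_apply
    (hasLineDerivAt_tangentVec c a z)).fun_add
    (HasDerivAt.clm_apply h1 (hasLineDerivAt_fibreVec (idx c + idx b) a z))
  simp only [zero_smul, add_zero, add_apply] at this
  simp only [HasLineDerivAt, totalTwo, totalThree]
  convert this using 1
  ring

/-- The components `τ`, `ξˣ`, `ξʸ` of a vector field. -/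
def horizontal (Q : VField m) (k : Fin 3) (p : PointSpace m) : ℝ := (Q p).1 k

/-- The components `ηⁱ` of a vector field. -/
def vertical (Q : VField m) (i : Fin m) (p : PointSpace m) : ℝ := (Q p).2 i

theorem contDiffAt_horizontal {Q : VField m} {p : PointSpace m} (hQ : ContDiffAt ℝ ∞ Q p)
    (k : Fin 3) : ContDiffAt ℝ ∞ (horizontal Q k) p :=
  contDiffAt_pi.1 hQ.fst k

theorem contDiffAt_vertical {Q : VField m} {p : PointSpace m} (hQ : ContDiffAt ℝ ∞ Q p)
    (i : Fin m) : ContDiffAt ℝ ∞ (vertical Q i) p :=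
  contDiffAt_pi.1 hQ.snd i

theorem characteristic_eq (Q : VField m) (i : Fin m) :
    characteristic Q i = fun z => vertical Q i (toPoint z)
      - ∑ k, horizontal Q k (toPoint z) * z.2 i (idx k) := rfl

theorem hasLineDerivAt_characteristic {Q : VField m} {z : JetSpace m}
    (hQ : ContDiffAt ℝ ∞ Q (toPoint z)) (i : Fin m) (c : Fin 3) :
    HasLineDerivAt ℝ (characteristic Q i) (totalOne (vertical Q i) c z
      - ∑ k, (totalOne (horizontal Q k) c z * z.2 i (idx k)
        + horizontal Q k (toPoint z) * z.2 i (idx k + idx c))) z (jetShift c z) := by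
  rw [characteristic_eq]
  exact HasDerivAt.fun_sub (hasLineDerivAt_comp_totalOne (contDiffAt_vertical hQ i) c)
    (HasDerivAt.fun_sum fun k _ => (hasLineDerivAt_comp_totalOne (contDiffAt_horizontal hQ k) c).mul'
      (hasLineDerivAt_coord i (idx k) z (jetShift c z)))

theorem totalDeriv_characteristic {Q : VField m} {z : JetSpace m}
    (hQ : ContDiffAt ℝ ∞ Q (toPoint z)) (i : Fin m) (c : Fin 3) :
    totalDeriv c (characteristic Q i) z = totalOne (vertical Q i) c z
      - ∑ k, (totalOne (horizontal Q k) c z * z.2 i (idx k)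
        + horizontal Q k (toPoint z) * z.2 i (idx k + idx c)) :=
  totalDeriv_eq_of_hasLineDerivAt (hasLineDerivAt_characteristic hQ i c)

theorem totalDeriv_totalDeriv_characteristic {U : Set (PointSpace m)} (hU : IsOpen U)
    {Q : VField m} (hQ : ContDiffOn ℝ ∞ Q U) {z : JetSpace m} (hz : toPoint z ∈ U)
    (i : Fin m) (b c : Fin 3) :
    totalDeriv b (totalDeriv c (characteristic Q i)) z = totalTwo (vertical Q i) b c z
      - ∑ k, (totalTwo (horizontal Q k) b c z * z.2 i (idx k)
        + totalOne (horizontal Q k) c z * z.2 i (idx k + idx b)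
        + totalOne (horizontal Q k) b z * z.2 i (idx k + idx c)
        + horizontal Q k (toPoint z) * z.2 i (idx k + idx c + idx b)) := by
  rw [totalDeriv_congr hU
    (fun z hz => totalDeriv_characteristic (hQ.contDiffAt (hU.mem_nhds hz)) i c) b hz]
  have hQz := hQ.contDiffAt (hU.mem_nhds hz)
  apply totalDeriv_eq_of_hasLineDerivAt
  have := HasDerivAt.fun_sub (hasLineDerivAt_totalOne (contDiffAt_vertical hQz i) b c)
    (HasDerivAt.fun_sum (u := Finset.univ) fun k _ => HasDerivAt.fun_add
      ((hasLineDerivAt_totalOne (contDiffAt_horizontal hQz k) b c).mul'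
        (hasLineDerivAt_coord i (idx k) z (jetShift b z)))
      ((hasLineDerivAt_comp_totalOne (contDiffAt_horizontal hQz k) b).mul'
        (hasLineDerivAt_coord i (idx k + idx c) z (jetShift b z))))
  refine HasDerivAt.congr_deriv this ?_
  congr 1
  refine Finset.sum_congr rfl fun k _ => ?_
  simp only [jetShift]
  ring

theorem totalDeriv_totalDeriv_totalDeriv_characteristic {U : Set (PointSpace m)} (hU : IsOpen U)
    {Q : VField m} (hQ : ContDiffOn ℝ ∞ Q U) {z : JetSpace m} (hz : toPoint z ∈ U)
    (i : Fin m) (a b c : Fin 3) :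
    totalDeriv a (totalDeriv b (totalDeriv c (characteristic Q i))) z
      = totalThree (vertical Q i) a b c z
      - ∑ k, (totalThree (horizontal Q k) a b c z * z.2 i (idx k)
        + totalTwo (horizontal Q k) b c z * z.2 i (idx k + idx a)
        + totalTwo (horizontal Q k) a c z * z.2 i (idx k + idx b)
        + totalTwo (horizontal Q k) a b z * z.2 i (idx k + idx c)
        + totalOne (horizontal Q k) a z * z.2 i (idx k + idx b + idx c)
        + totalOne (horizontal Q k) b z * z.2 i (idx k + idx a + idx c)
        + totalOne (horizontal Q k) c z * z.2 i (idx k + idx a + idx b)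
        + horizontal Q k (toPoint z) * z.2 i (idx a + idx b + idx c + idx k)) := by
  rw [totalDeriv_congr hU
    (fun z hz => totalDeriv_totalDeriv_characteristic hU hQ hz i b c) a hz]
  have hQz := hQ.contDiffAt (hU.mem_nhds hz)
  apply totalDeriv_eq_of_hasLineDerivAt
  have := HasDerivAt.fun_sub (hasLineDerivAt_totalTwo (contDiffAt_vertical hQz i) a b c)
    (HasDerivAt.fun_sum (u := Finset.univ) fun k _ => HasDerivAt.fun_add
      (HasDerivAt.fun_add (HasDerivAt.fun_add
      ((hasLineDerivAt_totalTwo (contDiffAt_horizontal hQz k) a b c).mul'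
        (hasLineDerivAt_coord i (idx k) z (jetShift a z)))
      ((hasLineDerivAt_totalOne (contDiffAt_horizontal hQz k) a c).mul'
        (hasLineDerivAt_coord i (idx k + idx b) z (jetShift a z))))
      ((hasLineDerivAt_totalOne (contDiffAt_horizontal hQz k) a b).mul'
        (hasLineDerivAt_coord i (idx k + idx c) z (jetShift a z))))
      ((hasLineDerivAt_comp_totalOne (contDiffAt_horizontal hQz k) a).mul'
        (hasLineDerivAt_coord i (idx k + idx c + idx b) z (jetShift a z))))
  refine HasDerivAt.congr_deriv this ?_
  congr 1
  refine Finset.sum_congr rfl fun k _ => ?_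
  simp only [jetShift]
  rw [show idx k + idx b + idx c = idx k + idx c + idx b by abel,
    show idx k + idx a + idx c = idx k + idx c + idx a by abel,
    show idx k + idx a + idx b = idx k + idx b + idx a by abel,
    show idx a + idx b + idx c + idx k = idx k + idx c + idx b + idx a by abel]
  ring

theorem prolongation_idx {Q : VField m} {z : JetSpace m}
    (hQ : ContDiffAt ℝ ∞ Q (toPoint z)) (i : Fin m) (a : Fin 3) :
    (prolongation Q z).2 i (idx a) = totalOne (vertical Q i) a z
      - ∑ k, totalOne (horizontal Q k) a z * z.2 i (idx k) := by
  simp only [prolongation, totalDerivMulti_idx, totalDeriv_characteristic hQ,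
    Finset.sum_add_distrib]
  simp only [horizontal, add_comm (idx a)]
  ring

/-- The fourth-order terms of D_a D_b D_c applied to the characteristic cancel against the sum that
`prolongation` adds, so only derivatives up to order three remain. -/
theorem prolongation_idx_three {U : Set (PointSpace m)} (hU : IsOpen U)
    {Q : VField m} (hQ : ContDiffOn ℝ ∞ Q U) {z : JetSpace m} (hz : toPoint z ∈ U)
    (i : Fin m) {a b c : Fin 3} (hab : a ≤ b) (hbc : b ≤ c) :
    (prolongation Q z).2 i (idx a + idx b + idx c) = totalThree (vertical Q i) a b c z
      - ∑ k, (totalThree (horizontal Q k) a b c z * z.2 i (idx k)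
        + totalTwo (horizontal Q k) b c z * z.2 i (idx k + idx a)
        + totalTwo (horizontal Q k) a c z * z.2 i (idx k + idx b)
        + totalTwo (horizontal Q k) a b z * z.2 i (idx k + idx c)
        + totalOne (horizontal Q k) a z * z.2 i (idx k + idx b + idx c)
        + totalOne (horizontal Q k) b z * z.2 i (idx k + idx a + idx c)
        + totalOne (horizontal Q k) c z * z.2 i (idx k + idx a + idx b)) := by
  simp only [prolongation, totalDerivMulti_idx_add_idx_add_idx _ hab hbc,
    totalDeriv_totalDeriv_totalDeriv_characteristic hU hQ hz]
  rw [Finset.sum_add_distrib]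
  simp only [horizontal]
  ring

/-- The sum over the layers adjacent to the layer `i`, weighted by the coupling constants. -/
def coupling (f : Fin m → Fin m → ℝ) (i : Fin m) (u : Fin m → ℝ) : ℝ :=
  ∑ j : Fin m, if i.val + 1 = j.val ∨ j.val + 1 = i.val then f i j * (u j - u i) else 0

theorem hasLineDerivAt_coupling (f : Fin m → Fin m → ℝ) (i : Fin m) (J : Fin 3 → ℕ)
    (z v : JetSpace m) :
    HasLineDerivAt ℝ (fun z : JetSpace m => coupling f i fun j => z.2 j J)
      (coupling f i fun j => v.2 j J) z v := by
  refine HasDerivAt.fun_sum fun j _ => ?_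
  split_ifs
  · exact (HasDerivAt.fun_sub (hasLineDerivAt_coord j J z v)
      (hasLineDerivAt_coord i J z v)).const_mul _
  · exact hasDerivAt_const _ _

theorem totalDeriv_vorticity (f : Fin m → Fin m → ℝ) (β : ℝ) (i : Fin m) (k : Fin 3)
    (z : JetSpace m) :
    totalDeriv k (vorticity f β i) z = z.2 i (idx 1 + idx 1 + idx k)
      + z.2 i (idx 2 + idx 2 + idx k) + coupling f i (fun j => z.2 j (idx k))
      + β * (Pi.single k 1 : Fin 3 → ℝ) 2 := by
  apply totalDeriv_eq_of_hasLineDerivAt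
  have := HasDerivAt.fun_add (HasDerivAt.fun_add (HasDerivAt.fun_add
    (hasLineDerivAt_coord i (idx 1 + idx 1) z (jetShift k z))
    (hasLineDerivAt_coord i (idx 2 + idx 2) z (jetShift k z)))
    (hasLineDerivAt_coupling f i 0 z (jetShift k z)))
    (HasDerivAt.const_mul β (hasLineDerivAt_base 2 z (jetShift k z)))
  refine HasDerivAt.congr_deriv this ?_
  simp only [jetShift, zero_add]

theorem qgEquation_eq (f : Fin m → Fin m → ℝ) (β : ℝ) (i : Fin m) :
    qgEquation f β i = fun z : JetSpace m =>
      z.2 i (idx 0 + idx 1 + idx 1) + z.2 i (idx 0 + idx 2 + idx 2)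
      + coupling f i (fun j => z.2 j (idx 0))
      + z.2 i (idx 1) * (z.2 i (idx 1 + idx 1 + idx 2) + z.2 i (idx 2 + idx 2 + idx 2)
        + coupling f i (fun j => z.2 j (idx 2)) + β)
      - z.2 i (idx 2) * (z.2 i (idx 1 + idx 1 + idx 1) + z.2 i (idx 1 + idx 2 + idx 2)
        + coupling f i (fun j => z.2 j (idx 1))) := by
  funext z
  simp only [qgEquation, totalDeriv_vorticity]
  rw [show idx 0 + idx 1 + idx 1 = idx 1 + idx 1 + idx 0 by abel,
    show idx 0 + idx 2 + idx 2 = idx 2 + idx 2 + idx 0 by abel,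
    show idx 1 + idx 2 + idx 2 = idx 2 + idx 2 + idx 1 by abel]
  simp

theorem lineDeriv_qgEquation (f : Fin m → Fin m → ℝ) (β : ℝ) (i : Fin m) (z v : JetSpace m) :
    lineDeriv ℝ (qgEquation f β i) z v =
      v.2 i (idx 0 + idx 1 + idx 1) + v.2 i (idx 0 + idx 2 + idx 2)
      + coupling f i (fun j => v.2 j (idx 0))
      + v.2 i (idx 1) * (z.2 i (idx 1 + idx 1 + idx 2) + z.2 i (idx 2 + idx 2 + idx 2)
        + coupling f i (fun j => z.2 j (idx 2)) + β)
      + z.2 i (idx 1) * (v.2 i (idx 1 + idx 1 + idx 2) + v.2 i (idx 2 + idx 2 + idx 2)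
        + coupling f i (fun j => v.2 j (idx 2)))
      - v.2 i (idx 2) * (z.2 i (idx 1 + idx 1 + idx 1) + z.2 i (idx 1 + idx 2 + idx 2)
        + coupling f i (fun j => z.2 j (idx 1)))
      - z.2 i (idx 2) * (v.2 i (idx 1 + idx 1 + idx 1) + v.2 i (idx 1 + idx 2 + idx 2)
        + coupling f i (fun j => v.2 j (idx 1))) := by
  rw [qgEquation_eq]
  apply HasLineDerivAt.lineDeriv
  have hc := fun J : Fin 3 → ℕ => hasLineDerivAt_coord i J z v
  have hk := fun J : Fin 3 → ℕ => hasLineDerivAt_coupling f i J z v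
  have h₂ : HasLineDerivAt ℝ (fun z : JetSpace m => z.2 i (idx 1 + idx 1 + idx 2)
      + z.2 i (idx 2 + idx 2 + idx 2) + coupling f i (fun j => z.2 j (idx 2)) + β) _ z v :=
    HasDerivAt.add_const β (HasDerivAt.fun_add (HasDerivAt.fun_add
      (hc (idx 1 + idx 1 + idx 2)) (hc (idx 2 + idx 2 + idx 2))) (hk (idx 2)))
  have h₁ : HasLineDerivAt ℝ (fun z : JetSpace m => z.2 i (idx 1 + idx 1 + idx 1)
      + z.2 i (idx 1 + idx 2 + idx 2) + coupling f i (fun j => z.2 j (idx 1))) _ z v :=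
    HasDerivAt.fun_add (HasDerivAt.fun_add
      (hc (idx 1 + idx 1 + idx 1)) (hc (idx 1 + idx 2 + idx 2))) (hk (idx 1))
  have := HasDerivAt.fun_sub (HasDerivAt.fun_add (HasDerivAt.fun_add (HasDerivAt.fun_add
    (hc (idx 0 + idx 1 + idx 1)) (hc (idx 0 + idx 2 + idx 2))) (hk (idx 0)))
    ((hc (idx 1)).mul' h₂)) ((hc (idx 2)).mul' h₁)
  refine HasDerivAt.congr_deriv this ?_
  ring

end

/-! ### Jets without second-order derivatives and the first-order determining equations -/

section

/-- The jet over the point `p` with the first-order derivatives `a`, the third-order derivatives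
`c` and vanishing derivatives of the other orders. -/
def oddJet (p : PointSpace m) (a : Fin m → Fin 3 → ℝ) (c : Fin m → (Fin 3 → ℕ) → ℝ) :
    JetSpace m :=
  (p.1, fun i J => match J 0 + J 1 + J 2 with
    | 0 => p.2 i
    -- In total degree one J equals some `idx k`, and the sum selects `a i k`.
    | 1 => ∑ k, J k * a i k
    | 3 => c i J
    | _ => 0)

theorem idx_apply (k l : Fin 3) : idx k l = if l = k then 1 else 0 := by
  simp [idx, Pi.single_apply]

theorem idx_values : idx 0 0 = 1 ∧ idx 0 1 = 0 ∧ idx 0 2 = 0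
    ∧ idx 1 0 = 0 ∧ idx 1 1 = 1 ∧ idx 1 2 = 0
    ∧ idx 2 0 = 0 ∧ idx 2 1 = 0 ∧ idx 2 2 = 1 := by
  simp [idx_apply]

theorem degree_idx (k : Fin 3) : idx k 0 + idx k 1 + idx k 2 = 1 := by
  fin_cases k <;> simp [idx_apply]

variable (p : PointSpace m) (a : Fin m → Fin 3 → ℝ) (c d : Fin m → (Fin 3 → ℕ) → ℝ)

theorem toPoint_oddJet : toPoint (oddJet p a c) = p := rfl

theorem oddJet_idx (i : Fin m) (k : Fin 3) : (oddJet p a c).2 i (idx k) = a i k := by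
  simp only [oddJet, degree_idx]
  simp [idx_apply]

theorem oddJet_idx_two (i : Fin m) (k l : Fin 3) : (oddJet p a c).2 i (idx k + idx l) = 0 := by
  have h : (idx k + idx l) 0 + (idx k + idx l) 1 + (idx k + idx l) 2 = 2 := by
    have := degree_idx k; have := degree_idx l; simp only [Pi.add_apply]; omega
  simp only [oddJet, h]

theorem oddJet_idx_three (i : Fin m) (k l n : Fin 3) :
    (oddJet p a c).2 i (idx k + idx l + idx n) = c i (idx k + idx l + idx n) := by
  have h : (idx k + idx l + idx n) 0 + (idx k + idx l + idx n) 1 + (idx k + idx l + idx n) 2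
      = 3 := by
    have := degree_idx k; have := degree_idx l; have := degree_idx n
    simp only [Pi.add_apply]; omega
  simp only [oddJet, h]

/-- The vector with the components `aⁱ_k` in the fibre and `∂_k` in the base. -/
def slopeVec (k : Fin 3) : PointSpace m := (Pi.single k 1, fun i => a i k)

theorem tangentVec_oddJet (k : Fin 3) : tangentVec k (oddJet p a c) = slopeVec a k := by
  simp only [tangentVec, slopeVec, oddJet_idx]

theorem fibreVec_oddJet_two (k l : Fin 3) : fibreVec (idx k + idx l) (oddJet p a c) = 0 := by
  simp only [fibreVec, oddJet_idx_two]; rfl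

theorem fibreVec_oddJet_three (k l n : Fin 3) :
    fibreVec (idx k + idx l + idx n) (oddJet p a c)
      = (0, fun j => c j (idx k + idx l + idx n)) := by
  simp only [fibreVec, oddJet_idx_three]

/-- The part of the equation that depends on the third-order derivatives. -/
def qgPrincipal (i : Fin m) : ℝ :=
  c i (idx 0 + idx 1 + idx 1) + c i (idx 0 + idx 2 + idx 2)
    + a i 1 * (c i (idx 1 + idx 1 + idx 2) + c i (idx 2 + idx 2 + idx 2))
    - a i 2 * (c i (idx 1 + idx 1 + idx 1) + c i (idx 1 + idx 2 + idx 2))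

/-- The part of the equation that depends only on the first-order derivatives. -/
def qgLower (f : Fin m → Fin m → ℝ) (β : ℝ) (i : Fin m) : ℝ :=
  coupling f i (fun j => a j 0) + a i 1 * (coupling f i (fun j => a j 2) + β)
    - a i 2 * coupling f i (fun j => a j 1)

theorem qgEquation_oddJet (f : Fin m → Fin m → ℝ) (β : ℝ) (i : Fin m) :
    qgEquation f β i (oddJet p a c) = qgPrincipal a c i + qgLower a f β i := by
  simp only [qgEquation_eq, oddJet_idx, oddJet_idx_three, qgPrincipal, qgLower]
  ring

variable (Q : VField m)

/-- The prolongation coefficient at `ψⁱ_k`. -/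
def firstCoeff (i : Fin m) (k : Fin 3) : ℝ :=
  fderiv ℝ (vertical Q i) p (slopeVec a k)
    - ∑ l, fderiv ℝ (horizontal Q l) p (slopeVec a k) * a i l

/-- The part of the prolongation coefficient at `ψⁱ_{krs}` that is linear in the third-order
derivatives. -/
def thirdCoeffPrincipal (i : Fin m) (k r s : Fin 3) : ℝ :=
  fderiv ℝ (vertical Q i) p (0, fun j => c j (idx k + idx r + idx s))
    - ∑ l, (fderiv ℝ (horizontal Q l) p (0, fun j => c j (idx k + idx r + idx s)) * a i l
      + fderiv ℝ (horizontal Q l) p (slopeVec a k) * c i (idx l + idx r + idx s)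
      + fderiv ℝ (horizontal Q l) p (slopeVec a r) * c i (idx l + idx k + idx s)
      + fderiv ℝ (horizontal Q l) p (slopeVec a s) * c i (idx l + idx k + idx r))

/-- The part of the prolongation coefficient at `ψⁱ_{krs}` that depends only on the first-order
derivatives. -/
def thirdCoeffLower (i : Fin m) (k r s : Fin 3) : ℝ :=
  fderiv ℝ (fderiv ℝ (fderiv ℝ (vertical Q i))) p (slopeVec a k) (slopeVec a r) (slopeVec a s)
    - ∑ l, fderiv ℝ (fderiv ℝ (fderiv ℝ (horizontal Q l))) p
      (slopeVec a k) (slopeVec a r) (slopeVec a s) * a i l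

theorem prolongation_oddJet_idx {Q : VField m} {p : PointSpace m} (hQ : ContDiffAt ℝ ∞ Q p)
    (i : Fin m) (k : Fin 3) :
    (prolongation Q (oddJet p a c)).2 i (idx k) = firstCoeff p a Q i k := by
  rw [prolongation_idx (by exact hQ)]
  simp only [totalOne, toPoint_oddJet, tangentVec_oddJet, oddJet_idx, firstCoeff]

theorem prolongation_oddJet_idx_three {U : Set (PointSpace m)} (hU : IsOpen U)
    {Q : VField m} (hQ : ContDiffOn ℝ ∞ Q U) {p : PointSpace m} (hp : p ∈ U) (i : Fin m)
    {k r s : Fin 3} (hkr : k ≤ r) (hrs : r ≤ s) :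
    (prolongation Q (oddJet p a c)).2 i (idx k + idx r + idx s)
      = thirdCoeffPrincipal p a c Q i k r s + thirdCoeffLower p a Q i k r s := by
  rw [prolongation_idx_three hU hQ (by exact hp) i hkr hrs]
  simp only [totalOne, totalThree, toPoint_oddJet, tangentVec_oddJet, oddJet_idx,
    oddJet_idx_two, oddJet_idx_three, fibreVec_oddJet_two, fibreVec_oddJet_three,
    thirdCoeffPrincipal, thirdCoeffLower, map_zero, zero_apply,
    show idx s + idx r + idx k = idx k + idx r + idx s by abel]
  simp only [mul_zero, add_zero, add_mul, Finset.sum_add_distrib]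
  ring

/-- The part of the infinitesimal invariance criterion that is linear in the third-order
derivatives. -/
def criterionPrincipal (i : Fin m) : ℝ :=
  thirdCoeffPrincipal p a c Q i 0 1 1 + thirdCoeffPrincipal p a c Q i 0 2 2
    + firstCoeff p a Q i 1 * (c i (idx 1 + idx 1 + idx 2) + c i (idx 2 + idx 2 + idx 2))
    + a i 1 * (thirdCoeffPrincipal p a c Q i 1 1 2 + thirdCoeffPrincipal p a c Q i 2 2 2)
    - firstCoeff p a Q i 2 * (c i (idx 1 + idx 1 + idx 1) + c i (idx 1 + idx 2 + idx 2))
    - a i 2 * (thirdCoeffPrincipal p a c Q i 1 1 1 + thirdCoeffPrincipal p a c Q i 1 2 2)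

/-- The part of the infinitesimal invariance criterion that depends only on the first-order
derivatives. -/
def criterionLower (f : Fin m → Fin m → ℝ) (β : ℝ) (i : Fin m) : ℝ :=
  thirdCoeffLower p a Q i 0 1 1 + thirdCoeffLower p a Q i 0 2 2
    + coupling f i (fun j => firstCoeff p a Q j 0)
    + firstCoeff p a Q i 1 * (coupling f i (fun j => a j 2) + β)
    + a i 1 * (thirdCoeffLower p a Q i 1 1 2 + thirdCoeffLower p a Q i 2 2 2
      + coupling f i (fun j => firstCoeff p a Q j 2))
    - firstCoeff p a Q i 2 * coupling f i (fun j => a j 1)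
    - a i 2 * (thirdCoeffLower p a Q i 1 1 1 + thirdCoeffLower p a Q i 1 2 2
      + coupling f i (fun j => firstCoeff p a Q j 1))

variable {p Q} {U : Set (PointSpace m)} {f : Fin m → Fin m → ℝ} {β : ℝ}

/-- Without second-order derivatives every mixed term of the third prolongation drops out, and the
criterion separates into a part linear in `c` and a part free of `c`. -/
theorem IsLieSymmetryOn.criterion (hU : IsOpen U) (hQ : IsLieSymmetryOn f β U Q) (hp : p ∈ U)
    (hc : ∀ i, qgPrincipal a c i + qgLower a f β i = 0) (i : Fin m) :
    criterionPrincipal p a c Q i + criterionLower p a Q f β i = 0 := by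
  have h := hQ.2 (oddJet p a c) (by exact hp)
    (fun i => by rw [qgEquation_oddJet]; exact hc i) i
  have hd := hQ.1.contDiffAt (hU.mem_nhds hp)
  rw [lineDeriv_qgEquation] at h
  simp only [prolongation_oddJet_idx a c hd] at h
  rw [prolongation_oddJet_idx_three a c hU hQ.1 hp i (by decide) (by decide),
    prolongation_oddJet_idx_three a c hU hQ.1 hp i (by decide) (by decide),
    prolongation_oddJet_idx_three a c hU hQ.1 hp i (by decide) (by decide),
    prolongation_oddJet_idx_three a c hU hQ.1 hp i (by decide) (by decide),
    prolongation_oddJet_idx_three a c hU hQ.1 hp i (by decide) (by decide),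
    prolongation_oddJet_idx_three a c hU hQ.1 hp i (by decide) (by decide)] at h
  simp only [oddJet_idx, oddJet_idx_three] at h
  rw [← h]
  simp only [criterionPrincipal, criterionLower]
  ring

theorem thirdCoeffPrincipal_add (i : Fin m) (k r s : Fin 3) :
    thirdCoeffPrincipal p a (c + d) Q i k r s
      = thirdCoeffPrincipal p a c Q i k r s + thirdCoeffPrincipal p a d Q i k r s := by
  have h : ∀ J : Fin 3 → ℕ, ((0, fun j => c j J + d j J) : PointSpace m)
      = (0, fun j => c j J) + (0, fun j => d j J) := by
    intro J; ext <;> simp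
  simp only [thirdCoeffPrincipal, Pi.add_apply, h, map_add, add_mul, mul_add,
    Finset.sum_add_distrib]
  ring

theorem criterionPrincipal_add (i : Fin m) :
    criterionPrincipal p a (c + d) Q i
      = criterionPrincipal p a c Q i + criterionPrincipal p a d Q i := by
  simp only [criterionPrincipal, thirdCoeffPrincipal_add, Pi.add_apply]
  ring

-- The criterion is affine in the third-order derivatives: subtracting its instances at a solution
-- `c₀` and at the solution `c₀ + d` removes the lower part.
variable {d} in
theorem IsLieSymmetryOn.criterionPrincipal_eq_zero (hU : IsOpen U)
    (hQ : IsLieSymmetryOn f β U Q) (hp : p ∈ U) (hd : ∀ i, qgPrincipal a d i = 0) (i : Fin m) :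
    criterionPrincipal p a d Q i = 0 := by
  -- Among third-order multi-indices the condition singles out ψⁱ_txx, which enters the ith equation
  -- with coefficient 1, so any slopes extend to a solution.
  let c₀ : Fin m → (Fin 3 → ℕ) → ℝ := fun i J =>
    if J 0 = 1 ∧ J 1 = 2 then - qgLower a f β i else 0
  have hc₀ : ∀ i, qgPrincipal a c₀ i + qgLower a f β i = 0 := by
    intro i
    simp [qgPrincipal, c₀, idx_apply]
  have h₁ := hQ.criterion a c₀ hU hp hc₀ i
  have h₂ := hQ.criterion a (c₀ + d) hU hp (fun i => by
    rw [← hc₀ i, ← add_zero (qgPrincipal a c₀ i), ← hd i]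
    simp only [qgPrincipal, Pi.add_apply]
    ring) i
  rw [criterionPrincipal_add] at h₂
  linarith

/-- `∂_k` at a point -/
def baseVec (k : Fin 3) : PointSpace m := (Pi.single k 1, 0)

/-- `∂_{ψʲ}` at a point -/
def layerVec (j : Fin m) : PointSpace m := (0, Pi.single j 1)

theorem map_fibre {E : Type*} [NormedAddCommGroup E] [NormedSpace ℝ E]
    (L : PointSpace m →L[ℝ] E) (u : Fin m → ℝ) : L (0, u) = ∑ j, u j • L (layerVec j) := by
  have : ((0, u) : PointSpace m) = ∑ j, u j • layerVec j := by
    ext x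
    · simp [layerVec, Prod.fst_sum]
    · simp [layerVec, Finset.sum_apply, Pi.single_apply, Prod.snd_sum]
  rw [this, map_sum]
  simp

theorem slopeVec_eq (k : Fin 3) : slopeVec a k = baseVec k + (0, fun i => a i k) := by
  simp [slopeVec, baseVec]

/-- The third-order derivatives of a single layer. -/
def layerCubic (j : Fin m) (g : ℕ → ℕ → ℕ → ℝ) : Fin m → (Fin 3 → ℕ) → ℝ :=
  fun l J => if l = j then g (J 0) (J 1) (J 2) else 0

/-- Perturb ψʲ_yyy alone and put nonzero slopes in layer i alone. The jth equation is unaffected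
because ψʲ_yyy appears there with the factor ψʲ_x = 0, while the ith criterion sees ψʲ_yyy only
through the ψʲ-derivatives of Q, with the factor `b 1`. -/
theorem layer_coupling_zero (hU : IsOpen U) (hQ : IsLieSymmetryOn f β U Q) (hp : p ∈ U)
    {i j : Fin m} (hij : i ≠ j) (b : Fin 3 → ℝ) (hb : b 1 ≠ 0) :
    fderiv ℝ (vertical Q i) p (layerVec j)
      - ∑ l, fderiv ℝ (horizontal Q l) p (layerVec j) * b l = 0 := by
  let g : ℕ → ℕ → ℕ → ℝ := fun _ _ n => if n = 3 then 1 else 0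
  have h := hQ.criterionPrincipal_eq_zero (d := layerCubic j g)
    (fun l => if l = i then b else 0) hU hp (by
      intro l
      by_cases hl : l = j
      · subst hl
        simp [qgPrincipal, layerCubic, g, hij.symm, idx_apply]
      · simp [qgPrincipal, layerCubic, hl]) i
  simp only [criterionPrincipal, thirdCoeffPrincipal, layerCubic, g, hij, if_false, idx_values,
    Pi.add_apply, if_true, mul_zero, add_zero, map_fibre] at h
  simpa [hb] using h

theorem horizontal_layer (hm : 2 ≤ m) (hU : IsOpen U) (hQ : IsLieSymmetryOn f β U Q)
    (hp : p ∈ U) (k : Fin 3) (j : Fin m) : fderiv ℝ (horizontal Q k) p (layerVec j) = 0 := by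
  have : Nontrivial (Fin m) := Fin.nontrivial_iff_two_le.2 hm
  obtain ⟨i, hij⟩ := exists_ne j
  have h := fun b hb => layer_coupling_zero hU hQ hp hij b hb
  -- The relation is affine in the slopes: comparing the first choice with the second, third and
  -- fourth isolates the coefficients of ξˣ, τ and ξʸ.
  have h₁ := h ![0, 1, 0] (by simp)
  have h₂ := h ![0, 2, 0] (by simp)
  have h₃ := h ![1, 1, 0] (by simp)
  have h₄ := h ![0, 1, 1] (by simp)
  simp [Fin.sum_univ_three] at h₁ h₂ h₃ h₄
  fin_cases k <;> simp <;> linarith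

theorem vertical_layer (hm : 2 ≤ m) (hU : IsOpen U) (hQ : IsLieSymmetryOn f β U Q)
    (hp : p ∈ U) {i j : Fin m} (hij : i ≠ j) : fderiv ℝ (vertical Q i) p (layerVec j) = 0 := by
  have h := layer_coupling_zero hU hQ hp hij ![0, 1, 0] (by simp)
  simpa [horizontal_layer hm hU hQ hp] using h

theorem horizontal_fibre (hm : 2 ≤ m) (hU : IsOpen U) (hQ : IsLieSymmetryOn f β U Q)
    (hp : p ∈ U) (k : Fin 3) (u : Fin m → ℝ) : fderiv ℝ (horizontal Q k) p (0, u) = 0 := by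
  simp [map_fibre, horizontal_layer hm hU hQ hp]

theorem vertical_fibre (hm : 2 ≤ m) (hU : IsOpen U) (hQ : IsLieSymmetryOn f β U Q)
    (hp : p ∈ U) (i : Fin m) (u : Fin m → ℝ) :
    fderiv ℝ (vertical Q i) p (0, u) = u i * fderiv ℝ (vertical Q i) p (layerVec i) := by
  rw [map_fibre, Finset.sum_eq_single i]
  · simp
  · intro j _ hj
    rw [vertical_layer hm hU hQ hp hj.symm, smul_zero]
  · simp

theorem criterionPrincipal_layer (hU : IsOpen U) (hQ : IsLieSymmetryOn f β U Q)
    (hp : p ∈ U) (i : Fin m) (b : Fin 3 → ℝ) (g : ℕ → ℕ → ℕ → ℝ)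
    (hg : g 1 2 0 + g 1 0 2 + b 1 * (g 0 2 1 + g 0 0 3) - b 2 * (g 0 3 0 + g 0 1 2) = 0) :
    criterionPrincipal p (fun l => if l = i then b else 0) (layerCubic i g) Q i = 0 :=
  hQ.criterionPrincipal_eq_zero _ hU hp (by
    intro l
    by_cases hl : l = i
    · subst hl
      simpa [qgPrincipal, layerCubic, idx_apply] using hg
    · simp [qgPrincipal, layerCubic, hl]) i

/-- The relations between the first-order derivatives of the components of a symmetry. -/
theorem first_order_relations (hm : 2 ≤ m) (hU : IsOpen U) (hQ : IsLieSymmetryOn f β U Q)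
    (hp : p ∈ U) (i : Fin m) :
    fderiv ℝ (horizontal Q 0) p (baseVec 1) = 0
    ∧ fderiv ℝ (horizontal Q 0) p (baseVec 2) = 0
    ∧ fderiv ℝ (horizontal Q 1) p (baseVec 1) = fderiv ℝ (horizontal Q 2) p (baseVec 2)
    ∧ fderiv ℝ (horizontal Q 2) p (baseVec 1) = - fderiv ℝ (horizontal Q 1) p (baseVec 2)
    ∧ fderiv ℝ (vertical Q i) p (baseVec 1) = fderiv ℝ (horizontal Q 2) p (baseVec 0)
    ∧ fderiv ℝ (vertical Q i) p (baseVec 2) = - fderiv ℝ (horizontal Q 1) p (baseVec 0)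
    ∧ fderiv ℝ (vertical Q i) p (layerVec i) = 2 * fderiv ℝ (horizontal Q 1) p (baseVec 1)
      - fderiv ℝ (horizontal Q 0) p (baseVec 0) := by
  have h := fun b g hg => criterionPrincipal_layer hU hQ hp i b g hg
  simp only [criterionPrincipal, thirdCoeffPrincipal, firstCoeff, slopeVec_eq, map_add,
    horizontal_fibre hm hU hQ hp, vertical_fibre hm hU hQ hp, layerCubic, if_true,
    Fin.sum_univ_three, Pi.add_apply, idx_values, Nat.reduceAdd, add_zero, zero_mul, zero_add] at h
  -- At zero slopes the perturbations ψ_ttx, ψ_tty, ψ_txx - ψ_tyy, ψ_txy, ψ_yyy, ψ_xxx give the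
  -- first six relations in this order.
  have h₁ := h 0 (fun r s n => if r = 2 ∧ s = 1 then 1 else 0) (by simp)
  have h₂ := h 0 (fun r s n => if r = 2 ∧ n = 1 then 1 else 0) (by simp)
  have h₃ := h 0 (fun r s n => if r = 1 ∧ s = 2 then 1 else if r = 1 ∧ n = 2 then -1 else 0)
    (by simp)
  have h₄ := h 0 (fun r s n => if r = 1 ∧ s = 1 ∧ n = 1 then 1 else 0) (by simp)
  have h₅ := h 0 (fun r s n => if n = 3 then 1 else 0) (by simp)
  have h₆ := h 0 (fun r s n => if s = 3 then 1 else 0) (by simp)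
  -- With ψ_y = 1 the equation contains ψ_txx - ψ_xxx, so both are set to 1; this brings in the
  -- derivative of ηⁱ in ψⁱ.
  have h₇ := h ![0, 0, 1] (fun r s n => if s = 3 then 1 else if r = 1 ∧ s = 2 then 1 else 0)
    (by simp)
  simp at h₁ h₂ h₃ h₄ h₅ h₆ h₇
  refine ⟨by linarith, by linarith, by linarith, by linarith, by linarith, by linarith,
    by linarith⟩

end

/-! ### The slope part of the criterion and the vanishing of the stretching ξˣ_x -/

section

section DirDeriv

variable {E F : Type*} [NormedAddCommGroup E] [NormedSpace ℝ E] [NormedAddCommGroup F]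
  [NormedSpace ℝ F] {U : Set E} {g h : E → F}

/-- The derivative of a function along a constant vector field. -/
def dirDeriv (v : E) (g : E → F) : E → F := fun p => fderiv ℝ g p v

theorem dirDeriv_congr (hU : IsOpen U) (hgh : Set.EqOn g h U) (v : E) :
    Set.EqOn (dirDeriv v g) (dirDeriv v h) U := fun p hp => by
  simp only [dirDeriv]
  rw [(hgh.eventuallyEq_of_mem (hU.mem_nhds hp)).fderiv_eq]

theorem dirDeriv_eqOn_zero (hU : IsOpen U) (hg : Set.EqOn g 0 U) (v : E) :
    Set.EqOn (dirDeriv v g) 0 U :=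
  (dirDeriv_congr hU hg v).trans fun p _ => by simp [dirDeriv, Pi.zero_def]

theorem contDiffOn_dirDeriv (hU : IsOpen U) (hg : ContDiffOn ℝ ∞ g U) (v : E) :
    ContDiffOn ℝ ∞ (dirDeriv v g) U :=
  (hg.fderiv_of_isOpen hU (by simp)).clm_apply contDiffOn_const

theorem dirDeriv_dirDeriv (hU : IsOpen U) (hg : ContDiffOn ℝ ∞ g U) (u v : E) {p : E}
    (hp : p ∈ U) : dirDeriv v (dirDeriv u g) p = fderiv ℝ (fderiv ℝ g) p v u := by
  have hd := (hg.contDiffAt (hU.mem_nhds hp)).fderiv_infty.differentiableAt_infty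
  have := (hd.hasFDerivAt.clm_apply (hasFDerivAt_const u p)).fderiv
  change fderiv ℝ (fun q => fderiv ℝ g q u) p v = _
  rw [this]
  simp

theorem dirDeriv_comm (hU : IsOpen U) (hg : ContDiffOn ℝ ∞ g U) (u v : E) :
    Set.EqOn (dirDeriv v (dirDeriv u g)) (dirDeriv u (dirDeriv v g)) U := fun p hp => by
  rw [dirDeriv_dirDeriv hU hg _ _ hp, dirDeriv_dirDeriv hU hg _ _ hp]
  exact ((hg.contDiffAt (hU.mem_nhds hp)).isSymmSndFDerivAt (by
    rw [minSmoothness_of_isRCLikeNormedField]; exact ENat.LEInfty.out)).eq v u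

theorem dirDeriv_dirDeriv_dirDeriv (hU : IsOpen U) (hg : ContDiffOn ℝ ∞ g U) (u v w : E) {p : E}
    (hp : p ∈ U) : dirDeriv w (dirDeriv v (dirDeriv u g)) p
      = fderiv ℝ (fderiv ℝ (fderiv ℝ g)) p w v u := by
  rw [dirDeriv_congr hU (fun p hp => dirDeriv_dirDeriv hU hg u v hp) w hp]
  have hd := (hg.contDiffAt (hU.mem_nhds hp)).fderiv_infty.fderiv_infty.differentiableAt_infty
  have := ((hd.hasFDerivAt.clm_apply (hasFDerivAt_const v p)).clm_apply
    (hasFDerivAt_const u p)).fderiv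
  simp only [dirDeriv]
  rw [this]
  simp

theorem dirDeriv_neg (v : E) (g : E → F) : 
    dirDeriv v (fun p => - g p) = fun p => - dirDeriv v g p := by
  funext p
  simp only [dirDeriv, fderiv_fun_neg]
  rfl

theorem dirDeriv_sub_smul (hU : IsOpen U) (hg : ContDiffOn ℝ ∞ g U) (hh : ContDiffOn ℝ ∞ h U)
    (c : ℝ) (v : E) {p : E} (hp : p ∈ U) :
    dirDeriv v (fun p => g p - c • h p) p = dirDeriv v g p - c • dirDeriv v h p := by
  have h₁ := (hg.contDiffAt (hU.mem_nhds hp)).differentiableAt_infty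
  have h₂ := (hh.contDiffAt (hU.mem_nhds hp)).differentiableAt_infty
  simp only [dirDeriv]
  rw [fderiv_fun_sub h₁ (h₂.fun_const_smul c), fderiv_fun_const_smul h₂]
  rfl

end DirDeriv

section Coupling

variable (f : Fin m → Fin m → ℝ) (i : Fin m)

theorem coupling_congr {u v : Fin m → ℝ} (h : ∀ j, u j - u i = v j - v i) :
    coupling f i u = coupling f i v := by
  simp only [coupling, h]

theorem coupling_const (r : ℝ) : coupling f i (fun _ => r) = 0 := by
  simp [coupling]

theorem coupling_add_mul (u v : Fin m → ℝ) (r : ℝ) :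
    coupling f i (fun j => u j + v j * r) = coupling f i u + coupling f i v * r := by
  simp only [coupling, Finset.sum_mul, ← Finset.sum_add_distrib]
  refine Finset.sum_congr rfl fun j _ => ?_
  split_ifs <;> ring

theorem coupling_indicator {j : Fin m} (h : i.val + 1 = j.val ∨ j.val + 1 = i.val) :
    coupling f i (fun l => if l = j then 1 else 0) = f i j := by
  have hij : i ≠ j := by rintro rfl; omega
  rw [coupling, Finset.sum_eq_single j]
  · simp [h, hij]
  · intro l _ hl
    simp [hl, hij]
  · simp

end Coupling

variable {p : PointSpace m} {Q : VField m} {U : Set (PointSpace m)} {f : Fin m → Fin m → ℝ}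
  {β : ℝ}

theorem IsLieSymmetryOn.contDiffOn_horizontal (hQ : IsLieSymmetryOn f β U Q) (k : Fin 3) :
    ContDiffOn ℝ ∞ (horizontal Q k) U :=
  contDiffOn_pi.1 hQ.1.fst k

theorem IsLieSymmetryOn.contDiffOn_vertical (hQ : IsLieSymmetryOn f β U Q) (i : Fin m) :
    ContDiffOn ℝ ∞ (vertical Q i) U :=
  contDiffOn_pi.1 hQ.1.snd i

theorem firstCoeff_eq (hm : 2 ≤ m) (hU : IsOpen U) (hQ : IsLieSymmetryOn f β U Q) (hp : p ∈ U)
    (a : Fin m → Fin 3 → ℝ) (i : Fin m) (k : Fin 3) :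
    firstCoeff p a Q i k = fderiv ℝ (vertical Q i) p (baseVec k)
      + a i k * (2 * fderiv ℝ (horizontal Q 1) p (baseVec 1)
        - fderiv ℝ (horizontal Q 0) p (baseVec 0))
      - ∑ l, fderiv ℝ (horizontal Q l) p (baseVec k) * a i l := by
  simp only [firstCoeff, slopeVec_eq, map_add, horizontal_fibre hm hU hQ hp,
    vertical_fibre hm hU hQ hp, add_zero, (first_order_relations hm hU hQ hp i).2.2.2.2.2.2]

/-- The invariance criterion with the third-order derivatives eliminated. -/
theorem criterionLower_eq (hm : 2 ≤ m) (hU : IsOpen U) (hQ : IsLieSymmetryOn f β U Q)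
    (hp : p ∈ U) (a : Fin m → Fin 3 → ℝ) (i : Fin m) :
    criterionLower p a Q f β i
      + 2 * fderiv ℝ (horizontal Q 0) p (baseVec 0) * qgLower a f β i = 0 := by
  -- Only ψ_txx is nonzero in third order, with value `-qgLower`; by the first-order relations its
  -- coefficient in the criterion is ηⁱ_ψⁱ - τ_t - 2ξˣ_x = -2τ_t.
  have h := hQ.criterion a
    (fun i J => if J 0 = 1 ∧ J 1 = 2 then - qgLower a f β i else 0) hU hp
    (fun i => by simp [qgPrincipal, idx_apply]) i
  rw [← h, add_comm, add_right_cancel_iff]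
  obtain ⟨h₁, h₂, h₃, h₄, h₅, h₆, h₇⟩ := first_order_relations hm hU hQ hp i
  simp only [criterionPrincipal, thirdCoeffPrincipal, slopeVec_eq, map_add,
    horizontal_fibre hm hU hQ hp, vertical_fibre hm hU hQ hp,
    Fin.sum_univ_three, Pi.add_apply, idx_values, Nat.reduceAdd, add_zero, zero_mul, zero_add]
  simp [h₁, h₂, h₇]
  ring

theorem criterionLower_zero (hm : 2 ≤ m) (hU : IsOpen U) (hQ : IsLieSymmetryOn f β U Q)
    (hp : p ∈ U) (i : Fin m) :
    thirdCoeffLower p 0 Q i 0 1 1 + thirdCoeffLower p 0 Q i 0 2 2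
      + coupling f i (fun j => fderiv ℝ (vertical Q j) p (baseVec 0))
      + fderiv ℝ (vertical Q i) p (baseVec 1) * β = 0 := by
  have h := criterionLower_eq hm hU hQ hp 0 i
  simpa [criterionLower, qgLower, firstCoeff_eq hm hU hQ hp, coupling_const] using h

theorem fderiv_fderiv_fderiv_vertical_layer (hm : 2 ≤ m) (hU : IsOpen U) (hQ : IsLieSymmetryOn f β U Q)
    (hp : p ∈ U) {i j : Fin m} (hij : i ≠ j) (u v : PointSpace m) :
    fderiv ℝ (fderiv ℝ (fderiv ℝ (vertical Q i))) p (layerVec j) u v = 0 := by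
  have hη := hQ.contDiffOn_vertical i
  -- Commuting the derivatives makes the one in ψʲ innermost, where it vanishes on all of U.
  rw [← dirDeriv_dirDeriv_dirDeriv hU hη _ _ _ hp,
    dirDeriv_comm hU (contDiffOn_dirDeriv hU hη v) u (layerVec j) hp]
  exact dirDeriv_eqOn_zero hU ((dirDeriv_comm hU hη v (layerVec j)).trans
    (dirDeriv_eqOn_zero hU (fun q hq => vertical_layer hm hU hQ hq hij) v)) u hp

/-- Compare zero slopes with ψʲ_t = 1 in the single layer j next to the first layer i. The purely
differential terms of layer i do not notice the change, and the coupling terms change by f_ij (2ξˣ_x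
- 2τ_t) + 2τ_t f_ij = 2 f_ij ξˣ_x. -/
theorem horizontal_stretch (hm : 2 ≤ m) (hU : IsOpen U) (hQ : IsLieSymmetryOn f β U Q)
    (hp : p ∈ U) (hf : ∀ i j : Fin m, i.val + 1 = j.val → 0 < f i j * f j i) :
    fderiv ℝ (horizontal Q 1) p (baseVec 1) = 0 := by
  let i : Fin m := ⟨0, by omega⟩
  let j : Fin m := ⟨1, by omega⟩
  have hij : i ≠ j := by simp [i, j]
  have hfij : f i j ≠ 0 := left_ne_zero_of_mul (hf i j rfl).ne'
  let a : Fin m → Fin 3 → ℝ := fun l k => if l = j then (if k = 0 then 1 else 0) else 0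
  have hai : ∀ k, a i k = 0 := by simp [a, hij]
  have ha₁ : ∀ l, a l 1 = 0 := by simp [a]
  have ha₂ : ∀ l, a l 2 = 0 := by simp [a]
  have ha₀ : ∀ l, a l 0 = if l = j then 1 else 0 := by simp [a]
  have hs₀ : slopeVec a 0 = slopeVec 0 0 + layerVec j := by
    ext x
    · simp [slopeVec, layerVec]
    · simp [slopeVec, layerVec, Pi.single_apply, a]
  have hs₁ : slopeVec a 1 = slopeVec 0 1 := by ext x <;> simp [slopeVec, ha₁]
  have hs₂ : slopeVec a 2 = slopeVec 0 2 := by ext x <;> simp [slopeVec, ha₂]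
  have hK : thirdCoeffLower p a Q i 0 1 1 = thirdCoeffLower p 0 Q i 0 1 1
      ∧ thirdCoeffLower p a Q i 0 2 2 = thirdCoeffLower p 0 Q i 0 2 2 := by
    simp [thirdCoeffLower, hs₀, hs₁, hs₂, hai, fderiv_fderiv_fderiv_vertical_layer hm hU hQ hp hij]
  have h₀ := criterionLower_zero hm hU hQ hp i
  have h := criterionLower_eq hm hU hQ hp a i
  simp only [criterionLower, qgLower, hK.1, hK.2, hai, ha₁, ha₂,
    coupling_const, firstCoeff_eq hm hU hQ hp, Fin.sum_univ_three] at h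
  have hc := coupling_add_mul f i (fun l => fderiv ℝ (vertical Q l) p (baseVec 0))
    (fun l => a l 0) (2 * fderiv ℝ (horizontal Q 1) p (baseVec 1)
      - 2 * fderiv ℝ (horizontal Q 0) p (baseVec 0))
  have hc' : coupling f i (fun l => a l 0) = f i j := by
    simp only [ha₀]
    exact coupling_indicator f i (Or.inl rfl)
  rw [hc'] at h hc
  have hc'' := coupling_congr f i (u := fun l => fderiv ℝ (vertical Q l) p (baseVec 0)
      + a l 0 * (2 * fderiv ℝ (horizontal Q 1) p (baseVec 1)
        - fderiv ℝ (horizontal Q 0) p (baseVec 0))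
      - (fderiv ℝ (horizontal Q 0) p (baseVec 0) * a l 0
        + fderiv ℝ (horizontal Q 1) p (baseVec 0) * 0
        + fderiv ℝ (horizontal Q 2) p (baseVec 0) * 0))
    (v := fun l => fderiv ℝ (vertical Q l) p (baseVec 0) + a l 0 *
      (2 * fderiv ℝ (horizontal Q 1) p (baseVec 1)
      - 2 * fderiv ℝ (horizontal Q 0) p (baseVec 0))) (fun l => by ring)
  rw [hc'', hc] at h
  have : f i j * fderiv ℝ (horizontal Q 1) p (baseVec 1) = 0 := by linarith
  exact (mul_eq_zero.1 this).resolve_left hfij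

end

/-! ### The coupling as a path Laplacian, and the remaining determining equations -/

section

section Chain

variable {f : Fin m → Fin m → ℝ} {u : Fin m → ℝ} {r : ℝ}

/-- The part of `coupling` that comes from the layer `i + 1`. -/
def couplingNext (f : Fin m → Fin m → ℝ) (i : Fin m) (u : Fin m → ℝ) : ℝ :=
  ∑ j : Fin m, if i.val + 1 = j.val then f i j * (u j - u i) else 0

theorem couplingNext_eq {i j : Fin m} (h : i.val + 1 = j.val) :
    couplingNext f i u = f i j * (u j - u i) := by
  rw [couplingNext, Finset.sum_eq_single j]
  · simp [h]
  · intro l _ hl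
    rw [if_neg]
    exact fun h' => hl (Fin.ext (by omega))
  · simp

theorem couplingNext_last {i : Fin m} (h : i.val + 1 = m) : couplingNext f i u = 0 := by
  refine Finset.sum_eq_zero fun j _ => if_neg ?_
  have := j.isLt
  omega

theorem coupling_first {i : Fin m} (h : i.val = 0) : coupling f i u = couplingNext f i u := by
  refine Finset.sum_congr rfl fun j _ => ?_
  congr 1
  simp only [eq_iff_iff]
  omega

theorem coupling_succ {i j : Fin m} (h : i.val + 1 = j.val) :
    coupling f j u = couplingNext f j u + f j i * (u i - u j) := by
  have : f j i * (u i - u j) =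
      ∑ l : Fin m, if l.val + 1 = j.val then f j l * (u l - u j) else 0 := by
    rw [Finset.sum_eq_single i]
    · simp [h]
    · intro l _ hl
      rw [if_neg]
      exact fun h' => hl (Fin.ext (by omega))
    · simp
  rw [this, couplingNext, coupling, ← Finset.sum_add_distrib]
  refine Finset.sum_congr rfl fun l _ => ?_
  by_cases h₁ : j.val + 1 = l.val
  · have h₂ : ¬ l.val + 1 = j.val := by omega
    simp [h₁, h₂]
  · simp [h₁]

/-- Follow the flux from layer to layer. Each layer adds r, and passing an edge replaces one weight
by the opposite one of equal sign, so r times the outgoing flux stays at least r². The last layer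
has no outgoing flux. This is where the signs of the coupling constants matter, and not only that
they are nonzero. -/
theorem coupling_const_eq_zero (hm : 0 < m)
    (hf : ∀ i j : Fin m, i.val + 1 = j.val → 0 < f i j * f j i)
    (h : ∀ i, coupling f i u = r) : r = 0 := by
  have key : ∀ n (hn : n < m), r * r ≤ r * couplingNext f ⟨n, hn⟩ u := by
    intro n
    induction n with
    | zero => intro hn; rw [← coupling_first rfl, h]
    | succ n ih =>
      intro hn
      have hn' : n < m := by omega
      have hs : (⟨n, hn'⟩ : Fin m).val + 1 = (⟨n + 1, hn⟩ : Fin m).val := rfl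
      have h₁ := ih hn'
      rw [couplingNext_eq hs] at h₁
      have h₂ := h ⟨n + 1, hn⟩
      rw [coupling_succ hs] at h₂
      have h₃ := hf _ _ hs
      set α := f ⟨n, hn'⟩ ⟨n + 1, hn⟩
      set γ := f ⟨n + 1, hn⟩ ⟨n, hn'⟩
      set δ := u ⟨n + 1, hn⟩ - u ⟨n, hn'⟩ with hδ
      have h₄ : 0 ≤ r * (α * δ) := (mul_self_nonneg r).trans h₁
      have h₅ : 0 ≤ r * (γ * δ) := by
        -- Since α γ > 0, multiplying by it transfers the sign of r α δ to r γ δ without division.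
        have h₆ : 0 ≤ (α * γ) * (r * (γ * δ)) := by
          have : (α * γ) * (r * (γ * δ)) = (γ * γ) * (r * (α * δ)) := by ring
          rw [this]
          exact mul_nonneg (mul_self_nonneg γ) h₄
        exact nonneg_of_mul_nonneg_right h₆ h₃
      have h₇ : couplingNext f ⟨n + 1, hn⟩ u = r + γ * δ := by rw [hδ]; linarith
      rw [h₇, mul_add]
      linarith
  have hl := key (m - 1) (by omega)
  rw [couplingNext_last (show (m - 1) + 1 = m by omega), mul_zero] at hl
  exact mul_self_eq_zero.1 (le_antisymm hl (mul_self_nonneg r))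

/-- The flux out of the first layer is zero, and by induction so is every other; as the weights are
nonzero, neighbouring values agree. -/
theorem eq_of_coupling_eq_zero (hf : ∀ i j : Fin m, i.val + 1 = j.val → 0 < f i j * f j i)
    (h : ∀ i, coupling f i u = 0) (i j : Fin m) : u i = u j := by
  have key : ∀ n (hn : n < m), couplingNext f ⟨n, hn⟩ u = 0 ∧ u ⟨n, hn⟩ = u ⟨0, by omega⟩ := by
    intro n
    induction n with
    | zero => exact fun hn => ⟨by rw [← coupling_first rfl, h], rfl⟩
    | succ n ih =>
      intro hn
      have hn' : n < m := by omega
      have hs : (⟨n, hn'⟩ : Fin m).val + 1 = (⟨n + 1, hn⟩ : Fin m).val := rfl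
      obtain ⟨h₁, h₂⟩ := ih hn'
      rw [couplingNext_eq hs] at h₁
      have h₃ : u ⟨n + 1, hn⟩ = u ⟨n, hn'⟩ := sub_eq_zero.1
        ((mul_eq_zero.1 h₁).resolve_left (left_ne_zero_of_mul (hf _ _ hs).ne'))
      have h₄ := h ⟨n + 1, hn⟩
      rw [coupling_succ hs, h₃, sub_self, mul_zero, add_zero] at h₄
      exact ⟨h₄, h₃.trans h₂⟩
  exact (key i.val i.isLt).2.trans (key j.val j.isLt).2.symm

end Chain

variable {p : PointSpace m} {Q : VField m} {U : Set (PointSpace m)} {f : Fin m → Fin m → ℝ}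
  {β : ℝ}

/-- The vector `slopeVec` for first-order derivatives that are the same in all layers. -/
def uniformVec (b : Fin 3 → ℝ) (k : Fin 3) : PointSpace m := slopeVec (fun _ => b) k

theorem dirDeriv_uniformVec_horizontal (hm : 2 ≤ m) (hU : IsOpen U)
    (hQ : IsLieSymmetryOn f β U Q) (b : Fin 3 → ℝ) (l k : Fin 3) :
    Set.EqOn (dirDeriv (uniformVec b k) (horizontal Q l))
      (dirDeriv (baseVec k) (horizontal Q l)) U := fun q hq => by
  simp [dirDeriv, uniformVec, slopeVec_eq, horizontal_fibre hm hU hQ hq]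

theorem dirDeriv_uniformVec_baseVec_horizontal (hm : 2 ≤ m) (hU : IsOpen U)
    (hQ : IsLieSymmetryOn f β U Q) (b : Fin 3 → ℝ) (l k r : Fin 3) :
    Set.EqOn (dirDeriv (uniformVec b k) (dirDeriv (baseVec r) (horizontal Q l)))
      (dirDeriv (baseVec r) (dirDeriv (baseVec k) (horizontal Q l))) U :=
  (dirDeriv_comm hU (hQ.contDiffOn_horizontal l) _ _).trans
    (dirDeriv_congr hU (dirDeriv_uniformVec_horizontal hm hU hQ b l k) _)

/-- The spatial second-order derivatives of the spatial components vanish. -/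
theorem dirDeriv_dirDeriv_horizontal_eq_zero (hm : 2 ≤ m) (hU : IsOpen U)
    (hQ : IsLieSymmetryOn f β U Q)
    (hf : ∀ i j : Fin m, i.val + 1 = j.val → 0 < f i j * f j i)
    {l k r : Fin 3} (hl : l ≠ 0) (hk : k ≠ 0) (hr : r ≠ 0) :
    Set.EqOn (dirDeriv (baseVec r) (dirDeriv (baseVec k) (horizontal Q l))) 0 U := by
  have i : Fin m := ⟨0, by omega⟩
  have h₁₁ : Set.EqOn (dirDeriv (baseVec 1) (horizontal Q 1)) 0 U := fun q hq =>
    horizontal_stretch hm hU hQ hq hf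
  have h₂₂ : Set.EqOn (dirDeriv (baseVec 2) (horizontal Q 2)) 0 U := fun q hq =>
    (first_order_relations hm hU hQ hq i).2.2.1.symm.trans (h₁₁ hq)
  have h₂₁ : Set.EqOn (dirDeriv (baseVec 1) (horizontal Q 2))
      (fun q => - dirDeriv (baseVec 2) (horizontal Q 1) q) U := fun q hq =>
    (first_order_relations hm hU hQ hq i).2.2.2.1
  have h₁₂ : Set.EqOn (dirDeriv (baseVec 2) (horizontal Q 1))
      (fun q => - dirDeriv (baseVec 1) (horizontal Q 2) q) U := fun q hq => by
    simp [h₂₁ hq]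
  have c₁ := fun u v => dirDeriv_comm hU (hQ.contDiffOn_horizontal 1) u v
  have c₂ := fun u v => dirDeriv_comm hU (hQ.contDiffOn_horizontal 2) u v
  -- An infinitesimal plane isometry is affine: ξˣ_xy and ξʸ_xy vanish with ξˣ_x and ξʸ_y, and then
  -- ξˣ_yy = -ξʸ_xy and ξʸ_xx = -ξˣ_xy vanish too.
  have e₁ : Set.EqOn (dirDeriv (baseVec 1) (dirDeriv (baseVec 2) (horizontal Q 1))) 0 U :=
    (c₁ _ _).trans (dirDeriv_eqOn_zero hU h₁₁ _)
  have e₂ : Set.EqOn (dirDeriv (baseVec 2) (dirDeriv (baseVec 1) (horizontal Q 2))) 0 U :=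
    (c₂ _ _).trans (dirDeriv_eqOn_zero hU h₂₂ _)
  have e₃ : Set.EqOn (dirDeriv (baseVec 2) (dirDeriv (baseVec 2) (horizontal Q 1))) 0 U :=
    (dirDeriv_congr hU h₁₂ _).trans fun q hq => by rw [dirDeriv_neg]; simp [e₂ hq]
  have e₄ : Set.EqOn (dirDeriv (baseVec 1) (dirDeriv (baseVec 1) (horizontal Q 2))) 0 U :=
    (dirDeriv_congr hU h₂₁ _).trans fun q hq => by rw [dirDeriv_neg]; simp [e₁ hq]
  have e₅ := dirDeriv_eqOn_zero hU h₁₁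
  have e₆ := dirDeriv_eqOn_zero hU h₂₂
  fin_cases l <;> fin_cases k <;> fin_cases r <;>
    first
      | exact absurd rfl hl | exact absurd rfl hk | exact absurd rfl hr
      | exact e₁ | exact e₂ | exact e₃ | exact e₄ | exact e₅ _ | exact e₆ _

theorem dirDeriv_time_eqOn_zero (hm : 2 ≤ m) (hU : IsOpen U)
    (hQ : IsLieSymmetryOn f β U Q) (b : Fin 3 → ℝ) {k : Fin 3} (hk : k ≠ 0) :
    Set.EqOn (dirDeriv (uniformVec b k) (dirDeriv (baseVec 0) (horizontal Q 0))) 0 U := by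
  have i : Fin m := ⟨0, by omega⟩
  refine (dirDeriv_uniformVec_baseVec_horizontal hm hU hQ b 0 k 0).trans
    (dirDeriv_eqOn_zero hU (fun q hq => ?_) _)
  have h := first_order_relations hm hU hQ hq i
  fin_cases k
  · exact absurd rfl hk
  · exact h.1
  · exact h.2.1

theorem dirDeriv_uniformVec_vertical (hm : 2 ≤ m) (hU : IsOpen U)
    (hQ : IsLieSymmetryOn f β U Q)
    (hf : ∀ i j : Fin m, i.val + 1 = j.val → 0 < f i j * f j i) (b : Fin 3 → ℝ) (i : Fin m)
    (k : Fin 3) : Set.EqOn (dirDeriv (uniformVec b k) (vertical Q i))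
      (fun q => dirDeriv (baseVec k) (vertical Q i) q
        - b k • dirDeriv (baseVec 0) (horizontal Q 0) q) U := fun q hq => by
  have h := (first_order_relations hm hU hQ hq i).2.2.2.2.2.2
  simp [dirDeriv, uniformVec, slopeVec_eq, vertical_fibre hm hU hQ hq, h,
    horizontal_stretch hm hU hQ hq hf]
  ring

/-- The first total derivative depends on the slope only through the term -b_k τ_t, and τ_t is
annihilated by the next spatial one. -/
theorem dirDeriv_two_vertical (hm : 2 ≤ m) (hU : IsOpen U) (hQ : IsLieSymmetryOn f β U Q)
    (hf : ∀ i j : Fin m, i.val + 1 = j.val → 0 < f i j * f j i) (b : Fin 3 → ℝ) (i : Fin m)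
    {k r : Fin 3} (hr : r ≠ 0) :
    Set.EqOn (dirDeriv (uniformVec b r) (dirDeriv (uniformVec b k) (vertical Q i)))
      (dirDeriv (uniformVec b r) (dirDeriv (baseVec k) (vertical Q i))) U :=
  (dirDeriv_congr hU (dirDeriv_uniformVec_vertical hm hU hQ hf b i k) _).trans fun q hq => by
    rw [dirDeriv_sub_smul hU (contDiffOn_dirDeriv hU (hQ.contDiffOn_vertical i) _)
      (contDiffOn_dirDeriv hU (hQ.contDiffOn_horizontal 0) _) _ _ hq,
      dirDeriv_time_eqOn_zero hm hU hQ b hr hq]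
    simp

theorem dirDeriv_two_vertical_one (hm : 2 ≤ m) (hU : IsOpen U) (hQ : IsLieSymmetryOn f β U Q)
    (hf : ∀ i j : Fin m, i.val + 1 = j.val → 0 < f i j * f j i) (b : Fin 3 → ℝ) (i : Fin m)
    {r : Fin 3} (hr : r ≠ 0) :
    Set.EqOn (dirDeriv (uniformVec b r) (dirDeriv (uniformVec b 1) (vertical Q i)))
      (dirDeriv (baseVec 0) (dirDeriv (baseVec r) (horizontal Q 2))) U :=
  ((dirDeriv_two_vertical hm hU hQ hf b i hr).trans (dirDeriv_congr hU (fun _ hq =>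
    (first_order_relations hm hU hQ hq i).2.2.2.2.1) _)).trans
    (dirDeriv_uniformVec_baseVec_horizontal hm hU hQ b 2 r 0)

theorem dirDeriv_two_vertical_two (hm : 2 ≤ m) (hU : IsOpen U) (hQ : IsLieSymmetryOn f β U Q)
    (hf : ∀ i j : Fin m, i.val + 1 = j.val → 0 < f i j * f j i) (b : Fin 3 → ℝ) (i : Fin m)
    {r : Fin 3} (hr : r ≠ 0) :
    Set.EqOn (dirDeriv (uniformVec b r) (dirDeriv (uniformVec b 2) (vertical Q i)))
      (fun q => - dirDeriv (baseVec 0) (dirDeriv (baseVec r) (horizontal Q 1)) q) U :=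
  ((dirDeriv_two_vertical hm hU hQ hf b i hr).trans (dirDeriv_congr hU
    (h := fun q => - dirDeriv (baseVec 0) (horizontal Q 1) q) (fun q hq =>
    (first_order_relations hm hU hQ hq i).2.2.2.2.2.1) _)).trans fun q hq => by
      rw [dirDeriv_neg]
      simp [dirDeriv_uniformVec_baseVec_horizontal hm hU hQ b 1 r 0 hq]

theorem dirDeriv_three_horizontal (hm : 2 ≤ m) (hU : IsOpen U) (hQ : IsLieSymmetryOn f β U Q)
    (hf : ∀ i j : Fin m, i.val + 1 = j.val → 0 < f i j * f j i) (b : Fin 3 → ℝ)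
    {l k r : Fin 3} (hl : l ≠ 0) (hk : k ≠ 0) (hr : r ≠ 0) :
    Set.EqOn (dirDeriv (uniformVec b k) (dirDeriv (baseVec 0)
      (dirDeriv (baseVec r) (horizontal Q l)))) 0 U :=
  (dirDeriv_comm hU (contDiffOn_dirDeriv hU (hQ.contDiffOn_horizontal l) _) _ _).trans
    (dirDeriv_eqOn_zero hU
      ((dirDeriv_uniformVec_baseVec_horizontal hm hU hQ b l k r).trans
        (dirDeriv_dirDeriv_horizontal_eq_zero hm hU hQ hf hl hk hr)) _)

/-- The contributions of τ carry the factor `b 0 = 0`, and those of ξˣ and ξʸ contain two spatial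
derivatives of a spatial component. -/
theorem thirdCoeffLower_uniform (hm : 2 ≤ m) (hU : IsOpen U) (hQ : IsLieSymmetryOn f β U Q)
    (hf : ∀ i j : Fin m, i.val + 1 = j.val → 0 < f i j * f j i) {b : Fin 3 → ℝ} (hb : b 0 = 0)
    (hp : p ∈ U) (i : Fin m) (k : Fin 3) {r s : Fin 3} (hr : r ≠ 0) (hs : s ≠ 0) :
    thirdCoeffLower p (fun _ => b) Q i k r s
      = dirDeriv (uniformVec b k) (dirDeriv (uniformVec b r) (dirDeriv (uniformVec b s)
        (vertical Q i))) p := by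
  rw [dirDeriv_dirDeriv_dirDeriv hU (hQ.contDiffOn_vertical i) _ _ _ hp, thirdCoeffLower,
    Finset.sum_eq_zero, sub_zero]
  · rfl
  · intro l _
    by_cases hl : l = 0
    · rw [hl, hb, mul_zero]
    · have := dirDeriv_eqOn_zero hU (((dirDeriv_congr hU
        (dirDeriv_uniformVec_horizontal hm hU hQ b l s) (uniformVec b r)).trans
        (dirDeriv_uniformVec_baseVec_horizontal hm hU hQ b l r s)).trans
        (dirDeriv_dirDeriv_horizontal_eq_zero hm hU hQ hf hl hr hs)) (uniformVec b k) hp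
      rw [dirDeriv_dirDeriv_dirDeriv hU (hQ.contDiffOn_horizontal l) _ _ _ hp] at this
      exact mul_eq_zero_of_left this _

/-- The invariance criterion for first-order derivatives that are the same in all layers. -/
theorem criterion_uniform (hm : 2 ≤ m) (hU : IsOpen U) (hQ : IsLieSymmetryOn f β U Q)
    (hf : ∀ i j : Fin m, i.val + 1 = j.val → 0 < f i j * f j i) {b : Fin 3 → ℝ} (hb : b 0 = 0)
    (hp : p ∈ U) :
    β * (b 1 * fderiv ℝ (horizontal Q 0) p (baseVec 0)
      - b 2 * fderiv ℝ (horizontal Q 2) p (baseVec 1)) = 0 := by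
  have i : Fin m := ⟨0, by omega⟩
  have n₁ : (1 : Fin 3) ≠ 0 := by decide
  have n₂ : (2 : Fin 3) ≠ 0 := by decide
  -- With no slope in t, the total time derivative is the one at zero slopes; hence the terms with
  -- one time derivative agree with those in `criterionLower_zero` and cancel.
  have hv : uniformVec b 0 = uniformVec (m := m) 0 0 := by
    simp [uniformVec, slopeVec, hb]
  have T := fun k {r s} hr hs =>
    thirdCoeffLower_uniform (r := r) (s := s) hm hU hQ hf hb hp i k hr hs
  have T₀ := fun k {r s} hr hs =>
    thirdCoeffLower_uniform (b := 0) (r := r) (s := s) hm hU hQ hf rfl hp i k hr hs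
  have neg_zero' : ∀ {g : PointSpace m → ℝ} {v : PointSpace m}, dirDeriv v g p = 0 →
      dirDeriv v (fun q => - g q) p = 0 := fun h => by rw [dirDeriv_neg]; simp [h]
  have k₀₁ : thirdCoeffLower p (fun _ => b) Q i 0 1 1 = thirdCoeffLower p 0 Q i 0 1 1 := by
    refine (T 0 n₁ n₁).trans (Eq.trans ?_ (T₀ 0 n₁ n₁).symm)
    rw [dirDeriv_congr hU (dirDeriv_two_vertical_one hm hU hQ hf b i n₁) _ hp,
      dirDeriv_congr hU (dirDeriv_two_vertical_one hm hU hQ hf 0 i n₁) _ hp, hv]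
  have k₀₂ : thirdCoeffLower p (fun _ => b) Q i 0 2 2 = thirdCoeffLower p 0 Q i 0 2 2 := by
    refine (T 0 n₂ n₂).trans (Eq.trans ?_ (T₀ 0 n₂ n₂).symm)
    rw [dirDeriv_congr hU (dirDeriv_two_vertical_two hm hU hQ hf b i n₂) _ hp,
      dirDeriv_congr hU (dirDeriv_two_vertical_two hm hU hQ hf 0 i n₂) _ hp, hv]
  have k₁₁₂ : thirdCoeffLower p (fun _ => b) Q i 1 1 2 = 0 := by
    rw [T 1 n₁ n₂, dirDeriv_congr hU (dirDeriv_two_vertical_two hm hU hQ hf b i n₁) _ hp]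
    exact neg_zero' (dirDeriv_three_horizontal hm hU hQ hf b n₁ n₁ n₁ hp)
  have k₂₂₂ : thirdCoeffLower p (fun _ => b) Q i 2 2 2 = 0 := by
    rw [T 2 n₂ n₂, dirDeriv_congr hU (dirDeriv_two_vertical_two hm hU hQ hf b i n₂) _ hp]
    exact neg_zero' (dirDeriv_three_horizontal hm hU hQ hf b n₁ n₂ n₂ hp)
  have k₁₁₁ : thirdCoeffLower p (fun _ => b) Q i 1 1 1 = 0 := by
    rw [T 1 n₁ n₁, dirDeriv_congr hU (dirDeriv_two_vertical_one hm hU hQ hf b i n₁) _ hp]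
    exact dirDeriv_three_horizontal hm hU hQ hf b n₂ n₁ n₁ hp
  have k₁₂₂ : thirdCoeffLower p (fun _ => b) Q i 1 2 2 = 0 := by
    rw [T 1 n₂ n₂, dirDeriv_congr hU (dirDeriv_two_vertical_two hm hU hQ hf b i n₂) _ hp]
    exact neg_zero' (dirDeriv_three_horizontal hm hU hQ hf b n₁ n₁ n₂ hp)
  have h₀ := criterionLower_zero hm hU hQ hp i
  have h := criterionLower_eq hm hU hQ hp (fun _ => b) i
  have R := fun j => first_order_relations hm hU hQ hp j
  have hμ := horizontal_stretch hm hU hQ hp hf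
  simp only [criterionLower, qgLower, k₀₁, k₀₂, k₁₁₂, k₂₂₂, k₁₁₁, k₁₂₂, coupling_const,
    firstCoeff_eq hm hU hQ hp, (R _).2.2.2.2.1, (R _).2.2.2.2.2.1, hμ, (R i).1, hb,
    Fin.sum_univ_three] at h h₀
  rw [coupling_congr f i (v := fun j => fderiv ℝ (vertical Q j) p (baseVec 0))
    (fun j => by ring)] at h
  linarith

/-- The first-order derivatives of the components of a symmetry, apart from `ξˣ_t` and `ηⁱ_t`. -/
theorem gradient_relations (hm : 2 ≤ m) (hU : IsOpen U) (hQ : IsLieSymmetryOn f β U Q)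
    (hf : ∀ i j : Fin m, i.val + 1 = j.val → 0 < f i j * f j i) (hβ : β ≠ 0) (hp : p ∈ U) :
    (∀ k, fderiv ℝ (horizontal Q 0) p (baseVec k) = 0)
    ∧ (∀ k, fderiv ℝ (horizontal Q 2) p (baseVec k) = 0)
    ∧ (∀ k ≠ 0, fderiv ℝ (horizontal Q 1) p (baseVec k) = 0)
    ∧ (∀ i u, fderiv ℝ (vertical Q i) p (0, u) = 0)
    ∧ (∀ i, fderiv ℝ (vertical Q i) p (baseVec 1) = 0)
    ∧ (∀ i, fderiv ℝ (vertical Q i) p (baseVec 2)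
      = - fderiv ℝ (horizontal Q 1) p (baseVec 0))
    ∧ (∀ i j, fderiv ℝ (vertical Q i) p (baseVec 0)
      = fderiv ℝ (vertical Q j) p (baseVec 0)) := by
  have n₁ : (1 : Fin 3) ≠ 0 := by decide
  have n₂ : (2 : Fin 3) ≠ 0 := by decide
  have i₀ : Fin m := ⟨0, by omega⟩
  have R := fun j => first_order_relations hm hU hQ hp j
  have hμ := horizontal_stretch hm hU hQ hp hf
  have hτ : fderiv ℝ (horizontal Q 0) p (baseVec 0) = 0 := by
    -- A slope in x isolates τ_t; below, a slope in y isolates ξʸ_x.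
    have := criterion_uniform hm hU hQ hf (b := ![0, 1, 0]) rfl hp
    simpa [hβ] using this
  have hω : ∀ q ∈ U, fderiv ℝ (horizontal Q 2) q (baseVec 1) = 0 := fun q hq => by
    have := criterion_uniform hm hU hQ hf (b := ![0, 0, 1]) rfl hq
    simpa [hβ] using this
  have hω' : ∀ q ∈ U, fderiv ℝ (horizontal Q 1) q (baseVec 2) = 0 := fun q hq => by
    have := (first_order_relations hm hU hQ hq i₀).2.2.2.1
    rw [hω q hq] at this
    linarith
  have hθ : ∀ i, fderiv ℝ (vertical Q i) p (layerVec i) = 0 := fun i => by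
    rw [(R i).2.2.2.2.2.2, hμ, hτ]; ring
  have hK₁ : ∀ i, thirdCoeffLower p 0 Q i 0 1 1 = 0 := fun i => by
    refine (thirdCoeffLower_uniform (b := 0) hm hU hQ hf rfl hp i 0 n₁ n₁).trans ?_
    rw [dirDeriv_congr hU (dirDeriv_two_vertical_one hm hU hQ hf 0 i n₁) _ hp]
    exact dirDeriv_eqOn_zero hU (dirDeriv_eqOn_zero hU hω _) _ hp
  have hK₂ : ∀ i, thirdCoeffLower p 0 Q i 0 2 2 = 0 := fun i => by
    refine (thirdCoeffLower_uniform (b := 0) hm hU hQ hf rfl hp i 0 n₂ n₂).trans ?_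
    rw [dirDeriv_congr hU (dirDeriv_two_vertical_two hm hU hQ hf 0 i n₂) _ hp, dirDeriv_neg]
    exact neg_eq_zero.2 (dirDeriv_eqOn_zero hU (dirDeriv_eqOn_zero hU hω' _) _ hp)
  -- The right-hand side is the same for all layers, as both lemmas on the path Laplacian require.
  have hc : ∀ i, coupling f i (fun j => fderiv ℝ (vertical Q j) p (baseVec 0))
      = - (fderiv ℝ (horizontal Q 2) p (baseVec 0) * β) := fun i => by
    have h := criterionLower_zero hm hU hQ hp i
    rw [hK₁, hK₂, (R i).2.2.2.2.1] at h
    linarith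
  have h₂₀ : fderiv ℝ (horizontal Q 2) p (baseVec 0) = 0 := by
    have := coupling_const_eq_zero (by omega) hf hc
    simpa [hβ] using this
  refine ⟨fun k => ?_, fun k => ?_, fun k hk => ?_, fun i u => ?_, fun i => ?_,
    fun i => (R i).2.2.2.2.2.1, ?_⟩
  · fin_cases k
    exacts [hτ, (R i₀).1, (R i₀).2.1]
  · fin_cases k
    exacts [h₂₀, hω p hp, (R i₀).2.2.1.symm.trans hμ]
  · fin_cases k
    exacts [absurd rfl hk, hμ, hω' p hp]
  · rw [vertical_fibre hm hU hQ hp, hθ, mul_zero]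
  · rw [(R i).2.2.2.2.1, h₂₀]
  · exact eq_of_coupling_eq_zero hf fun i => by rw [hc, h₂₀]; simp

end

/-! ### Integration of the gradient relations over a convex set -/

section

/-- A linear combination of the spanning fields. -/
def normalField (γ b : ℝ) (c : Fin m → ℝ) (χ κ : ℝ → ℝ) : VField m := fun p =>
  (![γ, χ (p.1 0), b], fun i => c i - p.1 2 * deriv χ (p.1 0) + κ (p.1 0))

/-- On `U` the vector field is a linear combination of the spanning fields. -/
def IsNormalOn (U : Set (PointSpace m)) (Q : VField m) : Prop :=
  ∃ (γ b : ℝ) (c : Fin m → ℝ) (χ κ : ℝ → ℝ), ContDiffOn ℝ ∞ χ (timeRange U)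
    ∧ ContDiffOn ℝ ∞ κ (timeRange U) ∧ Set.EqOn Q (normalField γ b c χ κ) U

variable {p : PointSpace m} {Q : VField m} {U : Set (PointSpace m)} {f : Fin m → Fin m → ℝ}
  {β : ℝ}

/-- The coordinate `k` of the base as a linear map. -/
def coordCLM (k : Fin 3) : PointSpace m →L[ℝ] ℝ :=
  (ContinuousLinearMap.proj k).comp (ContinuousLinearMap.fst ℝ (Fin 3 → ℝ) (Fin m → ℝ))

theorem coordCLM_apply (k : Fin 3) (p : PointSpace m) : coordCLM k p = p.1 k := rfl

theorem hasFDerivAt_coord (k : Fin 3) (p : PointSpace m) :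
    HasFDerivAt (fun p : PointSpace m => p.1 k) (coordCLM k) p :=
  (coordCLM k).hasFDerivAt

theorem contDiff_coord (k : Fin 3) : ContDiff ℝ ∞ (fun p : PointSpace m => p.1 k) :=
  (coordCLM k).contDiff

theorem mapsTo_timeRange : Set.MapsTo (fun p : PointSpace m => p.1 0) U (timeRange U) :=
  Set.mapsTo_image _ _

theorem isOpen_timeRange (hU : IsOpen U) : IsOpen (timeRange U) :=
  ((isOpenMap_eval 0).comp isOpenMap_fst) U hU

theorem contDiffOn_deriv_timeRange (hU : IsOpen U) {χ : ℝ → ℝ}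
    (hχ : ContDiffOn ℝ ∞ χ (timeRange U)) : ContDiffOn ℝ ∞ (deriv χ) (timeRange U) :=
  hχ.deriv_of_isOpen (isOpen_timeRange hU) (by simp)

theorem hasDerivAt_timeRange (hU : IsOpen U) {χ : ℝ → ℝ}
    (hχ : ContDiffOn ℝ ∞ χ (timeRange U)) {t : ℝ} (ht : t ∈ timeRange U) :
    HasDerivAt χ (deriv χ t) t :=
  ((hχ.contDiffAt ((isOpen_timeRange hU).mem_nhds ht)).differentiableAt_infty).hasDerivAt

theorem hasFDerivAt_comp_time (hU : IsOpen U) {χ : ℝ → ℝ}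
    (hχ : ContDiffOn ℝ ∞ χ (timeRange U)) (hp : p ∈ U) :
    HasFDerivAt (fun p : PointSpace m => χ (p.1 0)) (deriv χ (p.1 0) • coordCLM 0) p :=
  (hasDerivAt_timeRange hU hχ (mapsTo_timeRange hp)).comp_hasFDerivAt p (hasFDerivAt_coord 0 p)

theorem map_eq_sum_baseVec (L : PointSpace m →L[ℝ] ℝ) (v : PointSpace m) :
    L v = v.1 0 * L (baseVec 0) + v.1 1 * L (baseVec 1) + v.1 2 * L (baseVec 2)
      + L (0, v.2) := by
  have : v = v.1 0 • baseVec 0 + v.1 1 • baseVec 1 + v.1 2 • baseVec 2 + (0, v.2) := by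
    ext x
    · fin_cases x <;> simp [baseVec]
    · simp [baseVec]
  conv_lhs => rw [this]
  simp only [map_add, map_smul, smul_eq_mul]

/-- By convexity the segment from p to q stays in U, and its direction has no t-component. -/
theorem eq_of_time_eq (hU : IsOpen U) (hUc : Convex ℝ U) {g : PointSpace m → ℝ}
    (hg : ContDiffOn ℝ ∞ g U) (h : ∀ p ∈ U, ∀ v : PointSpace m, v.1 0 = 0 → fderiv ℝ g p v = 0)
    {p q : PointSpace m} (hp : p ∈ U) (hq : q ∈ U) (hpq : p.1 0 = q.1 0) : g q = g p := by
  have hmem : ∀ s ∈ Set.Icc (0 : ℝ) 1, p + s • (q - p) ∈ U := fun s hs =>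
    hUc.add_smul_sub_mem hp hq hs
  have hd : ∀ s ∈ Set.Icc (0 : ℝ) 1, HasDerivAt (fun s : ℝ => g (p + s • (q - p))) 0 s := by
    intro s hs
    have hl : HasDerivAt (fun s : ℝ => p + s • (q - p)) (q - p) s := by
      simpa using ((hasDerivAt_id s).smul_const (q - p)).const_add p
    have := ((hg.contDiffAt (hU.mem_nhds
      (hmem s hs))).differentiableAt_infty.hasFDerivAt).comp_hasDerivAt s hl
    rwa [h _ (hmem s hs) _ (by simp [hpq])] at this
  have := constant_of_has_deriv_right_zero (fun s hs => (hd s hs).continuousAt.continuousWithinAt)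
    (fun s hs => (hd s ⟨hs.1, hs.2.le⟩).hasDerivWithinAt) 1 (by simp)
  simpa using this

theorem exists_eqOn_comp_time (hU : IsOpen U) (hUc : Convex ℝ U) {g : PointSpace m → ℝ}
    (hg : ContDiffOn ℝ ∞ g U)
    (h : ∀ p ∈ U, ∀ v : PointSpace m, v.1 0 = 0 → fderiv ℝ g p v = 0) :
    ∃ χ : ℝ → ℝ, ContDiffOn ℝ ∞ χ (timeRange U) ∧ Set.EqOn g (fun p => χ (p.1 0)) U := by
  classical
  -- The chosen point is immaterial, because g is constant on each time slice of U; the default 0 is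
  -- used only outside `timeRange U`.
  let χ : ℝ → ℝ := fun t => if ht : ∃ p ∈ U, p.1 0 = t then g ht.choose else 0
  have hχ : Set.EqOn g (fun p => χ (p.1 0)) U := by
    intro p hp
    have ht : ∃ q ∈ U, q.1 0 = p.1 0 := ⟨p, hp, rfl⟩
    simp only [χ, dif_pos ht]
    exact eq_of_time_eq hU hUc hg h ht.choose_spec.1 hp ht.choose_spec.2
  refine ⟨χ, ?_, hχ⟩
  rintro _ ⟨p, hp, rfl⟩
  apply ContDiffAt.contDiffWithinAt
  -- Near the time of p, χ is g restricted to the line through p in the t-direction, which gives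
  -- smoothness despite the choices.
  let ℓ : ℝ → PointSpace m := fun t => p + (t - p.1 0) • baseVec 0
  have hℓ : ContDiff ℝ ∞ ℓ := by fun_prop
  have hℓ₀ : ℓ (p.1 0) = p := by simp [ℓ]
  have hgl : ContDiffAt ℝ ∞ (g ∘ ℓ) (p.1 0) :=
    ContDiffAt.comp _ (by rw [hℓ₀]; exact hg.contDiffAt (hU.mem_nhds hp)) hℓ.contDiffAt
  refine hgl.congr_of_eventuallyEq ?_
  have : ∀ᶠ t in nhds (p.1 0), ℓ t ∈ U :=
    hℓ.continuous.continuousAt.eventually_mem (by rw [hℓ₀]; exact hU.mem_nhds hp)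
  filter_upwards [this] with t ht
  rw [Function.comp_apply, hχ ht]
  simp [ℓ, baseVec]

theorem IsLieSymmetryOn.isNormalOn (hm : 2 ≤ m)
    (hf : ∀ i j : Fin m, i.val + 1 = j.val → 0 < f i j * f j i) (hβ : β ≠ 0) (hU : IsOpen U)
    (hUc : Convex ℝ U) (hQ : IsLieSymmetryOn f β U Q) : IsNormalOn U Q := by
  rcases U.eq_empty_or_nonempty with rfl | ⟨p₀, hp₀⟩
  · exact ⟨0, 0, 0, 0, 0, contDiffOn_const, contDiffOn_const, Set.eqOn_empty _ _⟩
  have R := fun p hp => gradient_relations (p := p) hm hU hQ hf hβ hp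
  have hξ := hQ.contDiffOn_horizontal
  have hη := hQ.contDiffOn_vertical
  have hξ₀ := fun k p hp u => horizontal_fibre (p := p) hm hU hQ hp k u
  have const : ∀ g : PointSpace m → ℝ, ContDiffOn ℝ ∞ g U →
      (∀ p ∈ U, ∀ v, fderiv ℝ g p v = 0) → ∀ p ∈ U, g p = g p₀ := fun g hg h p hp =>
    hU.is_const_of_fderiv_eq_zero hUc.isPreconnected (hg.differentiableOn (by simp))
      (fun q hq => ContinuousLinearMap.ext (h q hq)) hp hp₀
  have hτ := const _ (hξ 0) fun p hp v => by
    rw [map_eq_sum_baseVec]; simp [(R p hp).1, hξ₀ 0 p hp]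
  have hξ₂ := const _ (hξ 2) fun p hp v => by
    rw [map_eq_sum_baseVec]; simp [(R p hp).2.1, hξ₀ 2 p hp]
  obtain ⟨χ, hχ, hξχ⟩ := exists_eqOn_comp_time hU hUc (hξ 1) fun p hp v hv => by
    rw [map_eq_sum_baseVec]
    simp [hv, (R p hp).2.2.1, hξ₀ 1 p hp]
  have hχ' := contDiffOn_deriv_timeRange hU hχ
  have hξt : ∀ p ∈ U, fderiv ℝ (horizontal Q 1) p (baseVec 0) = deriv χ (p.1 0) := by
    intro p hp
    rw [(hξχ.eventuallyEq_of_mem (hU.mem_nhds hp)).fderiv_eq,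
      (hasFDerivAt_comp_time hU hχ hp).fderiv]
    simp [coordCLM_apply, baseVec]
  let i₀ : Fin m := ⟨0, by omega⟩
  have hyχ : ContDiffOn ℝ ∞ (fun p : PointSpace m => p.1 2 * deriv χ (p.1 0)) U :=
    (contDiff_coord 2).contDiffOn.mul
      (hχ'.comp (contDiff_coord 0).contDiffOn mapsTo_timeRange)
  -- Since ηⁱ_y = -ξˣ_t = -χ_t, adding y χ_t to the first η leaves a function of t. The other layers
  -- differ from the first by constants, which become the coefficients of the fields `fieldJ`.
  obtain ⟨κ, hκ, hηκ⟩ := exists_eqOn_comp_time hU hUc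
    (g := fun p => vertical Q i₀ p + p.1 2 * deriv χ (p.1 0)) ((hη i₀).add hyχ) (by
      intro p hp v hv
      have h₁ := ((hη i₀).contDiffAt (hU.mem_nhds hp)).differentiableAt_infty.hasFDerivAt
      have h₂ := (hasFDerivAt_coord 2 p).fun_mul (hasFDerivAt_comp_time hU hχ' hp)
      rw [(h₁.fun_add h₂).fderiv, add_apply, map_eq_sum_baseVec (fderiv ℝ _ p)]
      simp [coordCLM_apply, hv, (R p hp).2.2.2.1, (R p hp).2.2.2.2.1,
        (R p hp).2.2.2.2.2.1, hξt p hp]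
      ring)
  have hdiff : ∀ i, ∀ p ∈ U, vertical Q i p - vertical Q i₀ p
      = vertical Q i p₀ - vertical Q i₀ p₀ := fun i =>
    const (fun p => vertical Q i p - vertical Q i₀ p) ((hη i).sub (hη i₀)) fun p hp v => by
      have h₁ := fun j => ((hη j).contDiffAt (hU.mem_nhds hp)).differentiableAt_infty
      rw [fderiv_fun_sub (h₁ i) (h₁ i₀), sub_apply, map_eq_sum_baseVec,
        map_eq_sum_baseVec (fderiv ℝ (vertical Q i₀) p)]
      simp [(R p hp).2.2.2.1, (R p hp).2.2.2.2.1, (R p hp).2.2.2.2.2.1,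
        (R p hp).2.2.2.2.2.2 i i₀]
  refine ⟨horizontal Q 0 p₀, horizontal Q 2 p₀, fun i => vertical Q i p₀ - vertical Q i₀ p₀,
    χ, κ, hχ, hκ, fun p hp => Prod.ext (funext fun k => ?_) (funext fun i => ?_)⟩
  · fin_cases k
    exacts [hτ p hp, hξχ hp, hξ₂ p hp]
  · have h₁ := hdiff i p hp
    have h₂ := hηκ hp
    simp only at h₂
    change vertical Q i p = vertical Q i p₀ - vertical Q i₀ p₀ - p.1 2 * deriv χ (p.1 0) + κ (p.1 0)
    linarith

end

/-! ### Converse inclusion, linear span and Lie bracket -/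

section

variable {p : PointSpace m} {Q : VField m} {U : Set (PointSpace m)} {f : Fin m → Fin m → ℝ}
  {β : ℝ}

section Prolongation

variable {γ b : ℝ} {χ A B : ℝ → ℝ}

/-- The form that the iterated total derivatives of the characteristics of linear combinations of
the spanning fields take. -/
def normalJetFn (γ b : ℝ) (χ : ℝ → ℝ) (i : Fin m) (A B : ℝ → ℝ) (J : Fin 3 → ℕ)
    (z : JetSpace m) : ℝ :=
  A (z.1 0) + z.1 2 * B (z.1 0)
    - (γ * z.2 i (J + idx 0) + χ (z.1 0) * z.2 i (J + idx 1) + b * z.2 i (J + idx 2))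

theorem hasLineDerivAt_comp_time (hU : IsOpen U) (hχ : ContDiffOn ℝ ∞ χ (timeRange U))
    {z : JetSpace m} (hz : toPoint z ∈ U) (v : JetSpace m) :
    HasLineDerivAt ℝ (fun z : JetSpace m => χ (z.1 0)) (deriv χ (z.1 0) * v.1 0) z v := by
  have := hasLineDerivAt_comp_toPoint (hasFDerivAt_comp_time hU hχ hz).differentiableAt v
  rw [(hasFDerivAt_comp_time hU hχ hz).fderiv] at this
  exact this

theorem totalDeriv_normalJetFn (hU : IsOpen U) (hχ : ContDiffOn ℝ ∞ χ (timeRange U))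
    (hA : ContDiffOn ℝ ∞ A (timeRange U)) (hB : ContDiffOn ℝ ∞ B (timeRange U))
    {z : JetSpace m} (hz : toPoint z ∈ U) (i : Fin m) (J : Fin 3 → ℕ) (k : Fin 3) :
    totalDeriv k (normalJetFn γ b χ i A B J) z =
      deriv A (z.1 0) * (Pi.single k 1 : Fin 3 → ℝ) 0
      + ((Pi.single k 1 : Fin 3 → ℝ) 2 * B (z.1 0)
        + z.1 2 * (deriv B (z.1 0) * (Pi.single k 1 : Fin 3 → ℝ) 0))
      - (γ * z.2 i (J + idx k + idx 0)
        + (deriv χ (z.1 0) * (Pi.single k 1 : Fin 3 → ℝ) 0 * z.2 i (J + idx 1)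
          + χ (z.1 0) * z.2 i (J + idx k + idx 1)) + b * z.2 i (J + idx k + idx 2)) := by
  apply totalDeriv_eq_of_hasLineDerivAt
  have hc := fun J => hasLineDerivAt_coord i J z (jetShift k z)
  have ht := fun {g : ℝ → ℝ} (hg : ContDiffOn ℝ ∞ g (timeRange U)) =>
    hasLineDerivAt_comp_time hU hg hz (jetShift k z)
  have := HasDerivAt.fun_sub (HasDerivAt.fun_add (ht hA)
    ((hasLineDerivAt_base 2 z (jetShift k z)).mul' (ht hB)))
    (HasDerivAt.fun_add (HasDerivAt.fun_add (HasDerivAt.const_mul γ (hc (J + idx 0)))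
      ((ht hχ).mul' (hc (J + idx 1)))) (HasDerivAt.const_mul b (hc (J + idx 2))))
  refine HasDerivAt.congr_deriv this ?_
  simp only [jetShift, add_right_comm J (idx k)]

/-- The form is stable under spatial differentiation: A + yB becomes 0 under D_x and B under D_y, so
two spatial derivatives always remove it. -/
theorem totalDeriv_space_normalJetFn (hU : IsOpen U) (hχ : ContDiffOn ℝ ∞ χ (timeRange U))
    (hA : ContDiffOn ℝ ∞ A (timeRange U)) (hB : ContDiffOn ℝ ∞ B (timeRange U))
    {z : JetSpace m} (hz : toPoint z ∈ U) (i : Fin m) (J : Fin 3 → ℕ) {k : Fin 3} (hk : k ≠ 0) :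
    totalDeriv k (normalJetFn γ b χ i A B J) z
      = normalJetFn γ b χ i ((Pi.single k 1 : Fin 3 → ℝ) 2 • B) 0 (J + idx k) z := by
  rw [totalDeriv_normalJetFn hU hχ hA hB hz]
  simp [normalJetFn, Pi.single_apply, hk.symm]

theorem totalDeriv_space_two_normalJetFn (hU : IsOpen U) (hχ : ContDiffOn ℝ ∞ χ (timeRange U))
    (hA : ContDiffOn ℝ ∞ A (timeRange U)) (hB : ContDiffOn ℝ ∞ B (timeRange U))
    {z : JetSpace m} (hz : toPoint z ∈ U) (i : Fin m) (J : Fin 3 → ℕ) {k l : Fin 3} (hk : k ≠ 0)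
    (hl : l ≠ 0) :
    totalDeriv k (totalDeriv l (normalJetFn γ b χ i A B J)) z
      = normalJetFn γ b χ i 0 0 (J + idx l + idx k) z := by
  refine (totalDeriv_congr hU
    (fun z hz => totalDeriv_space_normalJetFn hU hχ hA hB hz i J hl) k hz).trans
    ((totalDeriv_space_normalJetFn (B := 0) hU hχ (contDiffOn_const.smul hB) contDiffOn_const
      hz i _ hk).trans ?_)
  rw [smul_zero]

theorem totalDeriv_three_normalJetFn (hU : IsOpen U) (hχ : ContDiffOn ℝ ∞ χ (timeRange U))
    (hA : ContDiffOn ℝ ∞ A (timeRange U)) (hB : ContDiffOn ℝ ∞ B (timeRange U))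
    {z : JetSpace m} (hz : toPoint z ∈ U) (i : Fin m) (J : Fin 3 → ℕ) (n : Fin 3) {k l : Fin 3}
    (hk : k ≠ 0) (hl : l ≠ 0) :
    totalDeriv n (totalDeriv k (totalDeriv l (normalJetFn γ b χ i A B J))) z
      = - (γ * z.2 i (J + idx l + idx k + idx n + idx 0)
        + (deriv χ (z.1 0) * (Pi.single n 1 : Fin 3 → ℝ) 0 * z.2 i (J + idx l + idx k + idx 1)
          + χ (z.1 0) * z.2 i (J + idx l + idx k + idx n + idx 1))
        + b * z.2 i (J + idx l + idx k + idx n + idx 2)) := by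
  refine (totalDeriv_congr hU
    (fun z hz => totalDeriv_space_two_normalJetFn hU hχ hA hB hz i J hk hl) n hz).trans
    ((totalDeriv_normalJetFn (A := 0) (B := 0) hU hχ contDiffOn_const contDiffOn_const
      hz i _ n).trans ?_)
  simp [Pi.zero_def]

end Prolongation

section Symmetry

variable {γ b : ℝ} {c : Fin m → ℝ} {χ κ : ℝ → ℝ}

theorem characteristic_normalField (hQ : Set.EqOn Q (normalField γ b c χ κ) U) (i : Fin m)
    {z : JetSpace m} (hz : toPoint z ∈ U) :
    characteristic Q i z
      = normalJetFn γ b χ i (fun t => c i + κ t) (fun t => - deriv χ t) 0 z := by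
  simp only [characteristic, hQ hz]
  simp [normalField, normalJetFn, Fin.sum_univ_three, toPoint]
  ring

theorem prolongation_normalField_idx (hU : IsOpen U) (hχ : ContDiffOn ℝ ∞ χ (timeRange U))
    (hκ : ContDiffOn ℝ ∞ κ (timeRange U)) (hQ : Set.EqOn Q (normalField γ b c χ κ) U)
    (i : Fin m) (k : Fin 3) {z : JetSpace m} (hz : toPoint z ∈ U) :
    (prolongation Q z).2 i (idx k) = (deriv κ (z.1 0) - z.1 2 * deriv (deriv χ) (z.1 0)
        - deriv χ (z.1 0) * z.2 i (idx 1)) * (Pi.single k 1 : Fin 3 → ℝ) 0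
      - deriv χ (z.1 0) * (Pi.single k 1 : Fin 3 → ℝ) 2 := by
  simp only [prolongation, totalDerivMulti_idx]
  rw [totalDeriv_congr hU (fun z hz => characteristic_normalField hQ i hz) k hz,
    totalDeriv_normalJetFn hU hχ (contDiffOn_const.add hκ)
      (contDiffOn_deriv_timeRange hU hχ).neg hz, hQ hz]
  simp [Fin.sum_univ_three, normalField, toPoint]
  ring

theorem prolongation_normalField_idx_three (hU : IsOpen U)
    (hχ : ContDiffOn ℝ ∞ χ (timeRange U))
    (hκ : ContDiffOn ℝ ∞ κ (timeRange U)) (hQ : Set.EqOn Q (normalField γ b c χ κ) U)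
    (i : Fin m) {n k l : Fin 3} (hnk : n ≤ k) (hkl : k ≤ l) (hk : k ≠ 0) (hl : l ≠ 0)
    {z : JetSpace m} (hz : toPoint z ∈ U) :
    (prolongation Q z).2 i (idx n + idx k + idx l)
      = - deriv χ (z.1 0) * (Pi.single n 1 : Fin 3 → ℝ) 0 * z.2 i (idx 1 + idx k + idx l) := by
  simp only [prolongation, totalDerivMulti_idx_add_idx_add_idx _ hnk hkl]
  rw [totalDeriv_congr hU (fun z hz => totalDeriv_congr hU (fun z hz => totalDeriv_congr hU
      (fun z hz => characteristic_normalField hQ i hz) l hz) k hz) n hz,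
    totalDeriv_three_normalJetFn hU hχ (contDiffOn_const.add hκ)
      (contDiffOn_deriv_timeRange hU hχ).neg hz i 0 n hk hl, hQ hz]
  simp only [Fin.sum_univ_three, normalField, toPoint, zero_add,
    show idx l + idx k + idx n = idx n + idx k + idx l by abel,
    show idx l + idx k + idx 1 = idx 1 + idx k + idx l by abel]
  simp
  ring

theorem contDiffOn_normalField (hU : IsOpen U) (hχ : ContDiffOn ℝ ∞ χ (timeRange U))
    (hκ : ContDiffOn ℝ ∞ κ (timeRange U)) : ContDiffOn ℝ ∞ (normalField γ b c χ κ) U := by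
  have ht := fun {g : ℝ → ℝ} (hg : ContDiffOn ℝ ∞ g (timeRange U)) =>
    hg.comp (contDiff_coord (m := m) 0).contDiffOn mapsTo_timeRange
  refine ContDiffOn.prodMk (contDiffOn_pi.2 fun k => ?_) (contDiffOn_pi.2 fun i => ?_)
  · fin_cases k
    exacts [contDiffOn_const, ht hχ, contDiffOn_const]
  · exact (contDiffOn_const.sub ((contDiff_coord 2).contDiffOn.mul
      (ht (contDiffOn_deriv_timeRange hU hχ)))).add (ht hκ)

/-- The coupling discards the layer-independent term κ_t - y χ_tt. The prolongation then sends qⁱ_t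
to -χ_t qⁱ_x and ψⁱ_y to -χ_t, and the two contributions to the equation cancel. -/
theorem IsNormalOn.isLieSymmetryOn (hU : IsOpen U) (hQ : IsNormalOn U Q) :
    IsLieSymmetryOn f β U Q := by
  obtain ⟨γ, b, c, χ, κ, hχ, hκ, hQ⟩ := hQ
  refine ⟨(contDiffOn_normalField hU hχ hκ).congr hQ, fun z hz _ i => ?_⟩
  have h₁ := fun j k => prolongation_normalField_idx hU hχ hκ hQ j k hz
  have h₃ := fun {n k l : Fin 3} hnk hkl hk hl =>
    prolongation_normalField_idx_three (n := n) (k := k) (l := l) hU hχ hκ hQ i hnk hkl hk hl hz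
  rw [lineDeriv_qgEquation, h₃ (by decide) (by decide) (by decide) (by decide),
    h₃ (by decide) (by decide) (by decide) (by decide),
    h₃ (by decide) (by decide) (by decide) (by decide),
    h₃ (by decide) (by decide) (by decide) (by decide),
    h₃ (by decide) (by decide) (by decide) (by decide),
    h₃ (by decide) (by decide) (by decide) (by decide)]
  simp only [h₁]
  have hc := coupling_add_mul f i
    (fun _ => deriv κ (z.1 0) - z.1 2 * deriv (deriv χ) (z.1 0))
    (fun j => z.2 j (idx 1)) (- deriv χ (z.1 0))
  rw [coupling_const] at hc
  have hc' := coupling_congr f i (u := fun j => (deriv κ (z.1 0)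
    - z.1 2 * deriv (deriv χ) (z.1 0) - deriv χ (z.1 0) * z.2 j (idx 1))
      * (Pi.single 0 1 : Fin 3 → ℝ) 0 - deriv χ (z.1 0) * (Pi.single 0 1 : Fin 3 → ℝ) 2)
    (v := fun j => deriv κ (z.1 0) - z.1 2 * deriv (deriv χ) (z.1 0)
      + z.2 j (idx 1) * (- deriv χ (z.1 0))) (fun j => by simp; ring)
  rw [hc', hc]
  simp [coupling_const]
  ring

end Symmetry

section Span

theorem isNormalOn_of_mem_spanningFields (hQ : Q ∈ spanningFields U) : IsNormalOn U Q := by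
  rcases hQ with ((((rfl | rfl) | ⟨χ, hχ, rfl⟩) | ⟨i, rfl⟩) | ⟨κ, hκ, rfl⟩)
  · refine ⟨1, 0, 0, 0, 0, contDiffOn_const, contDiffOn_const, fun p _ => ?_⟩
    refine Prod.ext (funext fun k => ?_) (funext fun i => ?_)
    · fin_cases k <;> simp [fieldPt, normalField]
    · simp [fieldPt, normalField, Pi.zero_def]
  · refine ⟨0, 1, 0, 0, 0, contDiffOn_const, contDiffOn_const, fun p _ => ?_⟩
    refine Prod.ext (funext fun k => ?_) (funext fun i => ?_)
    · fin_cases k <;> simp [fieldPy, normalField]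
    · simp [fieldPy, normalField, Pi.zero_def]
  · refine ⟨0, 0, 0, χ, 0, hχ, contDiffOn_const, fun p _ => ?_⟩
    refine Prod.ext (funext fun k => ?_) (funext fun i => ?_)
    · fin_cases k <;> simp [fieldPx, normalField]
    · simp [fieldPx, normalField]
  · refine ⟨0, 0, Pi.single i 1, 0, 0, contDiffOn_const, contDiffOn_const, fun p _ => ?_⟩
    refine Prod.ext (funext fun k => ?_) (funext fun j => ?_)
    · fin_cases k <;> simp [fieldJ, normalField]
    · simp [fieldJ, normalField, Pi.zero_def]
  · refine ⟨0, 0, 0, 0, κ, contDiffOn_const, hκ, fun p _ => ?_⟩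
    refine Prod.ext (funext fun k => ?_) (funext fun j => ?_)
    · fin_cases k <;> simp [fieldZ, normalField]
    · simp [fieldZ, normalField, Pi.zero_def]

/-- Additivity of `deriv` is available on `timeRange U`, where the parameter functions are smooth;
this is why normal forms are compared on U only. -/
theorem IsNormalOn.add (hU : IsOpen U) {Q₁ Q₂ : VField m} (h₁ : IsNormalOn U Q₁)
    (h₂ : IsNormalOn U Q₂) : IsNormalOn U (Q₁ + Q₂) := by
  obtain ⟨γ₁, b₁, c₁, χ₁, κ₁, hχ₁, hκ₁, hQ₁⟩ := h₁
  obtain ⟨γ₂, b₂, c₂, χ₂, κ₂, hχ₂, hκ₂, hQ₂⟩ := h₂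
  refine ⟨γ₁ + γ₂, b₁ + b₂, c₁ + c₂, χ₁ + χ₂, κ₁ + κ₂, hχ₁.add hχ₂, hκ₁.add hκ₂,
    fun p hp => ?_⟩
  have hd := ((hasDerivAt_timeRange hU hχ₁ (mapsTo_timeRange hp)).add
    (hasDerivAt_timeRange hU hχ₂ (mapsTo_timeRange hp))).deriv
  simp only at hd
  rw [Pi.add_apply, hQ₁ hp, hQ₂ hp]
  refine Prod.ext (funext fun k => ?_) (funext fun i => ?_)
  · fin_cases k <;> simp [normalField]
  · simp [normalField, hd]
    ring

theorem IsNormalOn.smul (hU : IsOpen U) (r : ℝ) (h : IsNormalOn U Q) : IsNormalOn U (r • Q) := by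
  obtain ⟨γ, b, c, χ, κ, hχ, hκ, hQ⟩ := h
  refine ⟨r * γ, r * b, r • c, r • χ, r • κ, contDiffOn_const.smul hχ, contDiffOn_const.smul hκ,
    fun p hp => ?_⟩
  have hd := ((hasDerivAt_timeRange hU hχ (mapsTo_timeRange hp)).const_smul r).deriv
  simp only at hd
  rw [Pi.smul_apply, hQ hp]
  refine Prod.ext (funext fun k => ?_) (funext fun i => ?_)
  · fin_cases k <;> simp [normalField]
  · simp [normalField, hd]
    ring

theorem normalField_mem_span {γ b : ℝ} {c : Fin m → ℝ} {χ κ : ℝ → ℝ}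
    (hχ : ContDiffOn ℝ ∞ χ (timeRange U)) (hκ : ContDiffOn ℝ ∞ κ (timeRange U)) :
    normalField γ b c χ κ ∈ Submodule.span ℝ (spanningFields U) := by
  have h : normalField γ b c χ κ
      = γ • fieldPt + b • fieldPy + fieldPx χ + ∑ i, c i • fieldJ i + fieldZ κ := by
    funext p
    refine Prod.ext (funext fun k => ?_) (funext fun i => ?_)
    · fin_cases k <;>
        simp [normalField, fieldPt, fieldPy, fieldPx, fieldJ, fieldZ, Prod.fst_sum]
    · simp [normalField, fieldPt, fieldPy, fieldPx, fieldJ, fieldZ, Prod.snd_sum,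
        Finset.sum_apply, Pi.single_apply]
      ring
  rw [h]
  have mem : ∀ {R : VField m}, R ∈ spanningFields U →
      R ∈ Submodule.span ℝ (spanningFields U) := fun hR => Submodule.subset_span hR
  refine add_mem (add_mem (add_mem (add_mem ?_ ?_) ?_) (sum_mem fun i _ => ?_)) ?_
  · exact Submodule.smul_mem _ _ (mem (Or.inl (Or.inl (Or.inl (Or.inl rfl)))))
  · exact Submodule.smul_mem _ _ (mem (Or.inl (Or.inl (Or.inl (Or.inr rfl)))))
  · exact mem (Or.inl (Or.inl (Or.inr ⟨χ, hχ, rfl⟩)))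
  · exact Submodule.smul_mem _ _ (mem (Or.inl (Or.inr ⟨i, rfl⟩)))
  · exact mem (Or.inr ⟨κ, hκ, rfl⟩)

theorem isNormalOn_iff_exists_mem_span (hU : IsOpen U) :
    IsNormalOn U Q ↔ ∃ G ∈ Submodule.span ℝ (spanningFields U), Set.EqOn Q G U := by
  constructor
  · rintro ⟨γ, b, c, χ, κ, hχ, hκ, hQ⟩
    exact ⟨_, normalField_mem_span hχ hκ, hQ⟩
  · rintro ⟨G, hG, hQG⟩
    have : IsNormalOn U G := by
      clear hQG
      induction hG using Submodule.span_induction with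
      | mem R hR => exact isNormalOn_of_mem_spanningFields hR
      | zero =>
        simpa using (isNormalOn_of_mem_spanningFields
          (U := U) (Q := fieldPt) (Or.inl (Or.inl (Or.inl (Or.inl rfl))))).smul hU 0
      | add R S _ _ hR hS => exact hR.add hU hS
      | smul r R _ hR => exact hR.smul hU r
    obtain ⟨γ, b, c, χ, κ, hχ, hκ, hG'⟩ := this
    exact ⟨γ, b, c, χ, κ, hχ, hκ, hQG.trans hG'⟩

end Span

section Bracket

variable {γ b : ℝ} {c : Fin m → ℝ} {χ κ : ℝ → ℝ}

theorem fderiv_normalField (hU : IsOpen U) (hχ : ContDiffOn ℝ ∞ χ (timeRange U))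
    (hκ : ContDiffOn ℝ ∞ κ (timeRange U)) (hp : p ∈ U) (v : PointSpace m) :
    fderiv ℝ (normalField γ b c χ κ) p v = (![0, deriv χ (p.1 0) * v.1 0, 0],
      fun _ => - (p.1 2 * (deriv (deriv χ) (p.1 0) * v.1 0) + deriv χ (p.1 0) * v.1 2)
        + deriv κ (p.1 0) * v.1 0) := by
  have hd := ((contDiffOn_normalField (γ := γ) (b := b) (c := c) hU hχ hκ).contDiffAt
    (hU.mem_nhds hp)).differentiableAt_infty
  have hfst : ∀ k, (fderiv ℝ (normalField γ b c χ κ) p v).1 k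
      = fderiv ℝ (fun q => (normalField γ b c χ κ q).1 k) p v := fun k => by
    have := ((hasFDerivAt_pi'.1 hd.hasFDerivAt.fst) k).fderiv
    rw [this]; rfl
  have hsnd : ∀ i, (fderiv ℝ (normalField γ b c χ κ) p v).2 i
      = fderiv ℝ (fun q => (normalField γ b c χ κ q).2 i) p v := fun i => by
    have := ((hasFDerivAt_pi'.1 hd.hasFDerivAt.snd) i).fderiv
    rw [this]; rfl
  refine Prod.ext (funext fun k => ?_) (funext fun i => ?_)
  · rw [hfst]
    fin_cases k
    · simp [normalField]
    · have := (hasFDerivAt_comp_time hU hχ hp).fderiv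
      simp [normalField, this, coordCLM_apply]
    · simp [normalField]
  · rw [hsnd]
    have := ((((hasFDerivAt_coord 2 p).fun_mul (hasFDerivAt_comp_time hU
      (contDiffOn_deriv_timeRange hU hχ) hp)).const_sub (c i)).fun_add
      (hasFDerivAt_comp_time hU hκ hp)).fderiv
    simp only [normalField]
    rw [this]
    simp [coordCLM_apply]

/-- The commutation relations are [∂_t, P(χ)] = P(χ_t), [∂_t, Z(κ)] = Z(κ_t), [∂_y, P(χ)] = -Z(χ_t),
and the other brackets of spanning fields vanish; the new parameter functions are read off from
these. -/
theorem IsNormalOn.lieBracket (hU : IsOpen U) {Q₁ Q₂ : VField m} (h₁ : IsNormalOn U Q₁)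
    (h₂ : IsNormalOn U Q₂) : IsNormalOn U (VectorField.lieBracket ℝ Q₁ Q₂) := by
  obtain ⟨γ₁, b₁, c₁, χ₁, κ₁, hχ₁, hκ₁, hQ₁⟩ := h₁
  obtain ⟨γ₂, b₂, c₂, χ₂, κ₂, hχ₂, hκ₂, hQ₂⟩ := h₂
  have d := fun {g : ℝ → ℝ} (hg : ContDiffOn ℝ ∞ g (timeRange U)) =>
    contDiffOn_deriv_timeRange hU hg
  refine ⟨0, 0, 0, fun t => γ₁ * deriv χ₂ t - γ₂ * deriv χ₁ t,
    fun t => γ₁ * deriv κ₂ t - γ₂ * deriv κ₁ t - b₁ * deriv χ₂ t + b₂ * deriv χ₁ t,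
    (contDiffOn_const.mul (d hχ₂)).sub (contDiffOn_const.mul (d hχ₁)),
    (((contDiffOn_const.mul (d hκ₂)).sub (contDiffOn_const.mul (d hκ₁))).sub
      (contDiffOn_const.mul (d hχ₂))).add (contDiffOn_const.mul (d hχ₁)), fun p hp => ?_⟩
  have e := fun {g : ℝ → ℝ} (hg : ContDiffOn ℝ ∞ g (timeRange U)) =>
    hasDerivAt_timeRange hU (d hg) (mapsTo_timeRange hp)
  have hd := (((e hχ₂).const_mul γ₁).fun_sub ((e hχ₁).const_mul γ₂)).deriv
  rw [VectorField.lieBracket, (hQ₁.eventuallyEq_of_mem (hU.mem_nhds hp)).fderiv_eq,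
    (hQ₂.eventuallyEq_of_mem (hU.mem_nhds hp)).fderiv_eq, hQ₁ hp, hQ₂ hp,
    fderiv_normalField hU hχ₁ hκ₁ hp, fderiv_normalField hU hχ₂ hκ₂ hp]
  refine Prod.ext (funext fun k => ?_) (funext fun i => ?_)
  · fin_cases k <;> simp [normalField]
    ring
  · simp only [normalField, hd]
    simp
    ring

end Bracket

end

end

end MultiLayerQG

open MultiLayerQG in
theorem mainTheorem1 (m : ℕ) (hm : 2 ≤ m) (f : Fin m → Fin m → ℝ) (β : ℝ)
    (hf : ∀ i j : Fin m, i.val + 1 = j.val → 0 < f i j * f j i) (hβ : β ≠ 0)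
    (U : Set (PointSpace m)) (hU : IsOpen U) (hUc : Convex ℝ U) :
    maxLieInvarianceAlgebra f β U
        = {Q | ∃ G ∈ Submodule.span ℝ (spanningFields U), Set.EqOn Q G U} ∧
      ∀ Q₁ ∈ maxLieInvarianceAlgebra f β U, ∀ Q₂ ∈ maxLieInvarianceAlgebra f β U,
        VectorField.lieBracket ℝ Q₁ Q₂ ∈ maxLieInvarianceAlgebra f β U := by
  have h : ∀ Q : VField m, IsLieSymmetryOn f β U Q ↔ IsNormalOn U Q := fun Q =>
    ⟨fun hQ => hQ.isNormalOn hm hf hβ hU hUc, fun hQ => hQ.isLieSymmetryOn hU⟩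
  refine ⟨Set.ext fun Q => (h Q).trans (isNormalOn_iff_exists_mem_span hU), ?_⟩
  intro Q₁ h₁ Q₂ h₂
  exact (h _).2 (((h _).1 h₁).lieBracket hU ((h _).1 h₂))
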